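/- Let $\mathcal S$ be a connected oriented surface without boundary (compact or not; in the non-compact case triangulations are assumed locally finite). A triangulation of $\mathcal S$ is a graph (loops and parallel edges allowed) embedded on $\mathcal S$ all of whose faces are open disks bounded by three sides of edges. It is called \emph{reducing} if every vertex has degree at least eight and its triangles are colored red or blue in such a way that triangles adjacent along an edge have different colors. Let $T$ be a reducing triangulation of $\mathcal S$. A closed walk (here of length at least one; a closed walk of length zero is contractible) is a cyclic sequence of directed edges of $T$, each starting at the vertex where the preceding one ends; closed walks that differ only in the choice of the starting vertex are regarded as equal. A closed walk defines a closed curve $S^1\to\mathcal S$, up to parameterization. Two closed walks are \emph{freely homotopic} if their closed curves are homotopic in $\mathcal S$ through closed curves (no basepoint being fixed), and a closed walk is \emph{contractible} if its closed curve is homotopic to a constant closed curve. Let $e,e'$ be consecutive directed edges of a closed walk, $e$ ending at the vertex $v$ and $e'$ starting at $v$. This occurrence of $v$ makes a \emph{$k$-turn} ($k\ge 0$) if exactly $k$ triangles lie to the left, between $e$ and $e'$ in the cyclic order around $v$, and a \emph{$-k$-turn} ($k\ge 1$) if exactly $k$ triangles lie to the right. A \emph{$k_r$-turn} (resp. \emph{$k_b$-turn})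 is a $k$-turn for which the triangle to the left of $e$ is red (resp. blue). The \emph{bad turns} are the $0$-, $1$-, $-1$-, $2_r$- and $-2_r$-turns. A closed walk is \emph{reduced} if none of its vertices makes a bad turn, not all of its vertices make a $3_r$-turn, and not all of its vertices make a $-3_b$-turn. \textbf{Proposition.} In a reducing triangulation $T$, any two freely homotopic, non-contractible, reduced closed walks are equal. -/

import Mathlib

namespace ReducingTri

/-! ### Oriented triangulated surfaces -/

/-- The combinatorial structure (half-edge data structure) of a locally finite triangulation of an
oriented surface without boundary. The elements of `D` are the directed edges. Loops, parallel
edges, and several incidences between a triangle and a vertex are allowed; `D` may be infinite.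

* `rev e` is the directed edge `e` traversed backwards;
* `next e` is the directed edge that follows `e` on the boundary of the triangle to the left of
  `e`, this boundary being traversed with the triangle to the left. -/
structure TriMap (D : Type*) where
  next : Equiv.Perm D
  rev : Equiv.Perm D
  next_next_next : ∀ e, next (next (next e)) = e
  next_ne : ∀ e, next e ≠ e
  rev_rev : ∀ e, rev (rev e) = e
  rev_ne : ∀ e, rev e ≠ e
  /-- Only finitely many directed edges leave a given vertex. -/
  locallyFinite : ∀ e, {e' | (next * rev).SameCycle e e'}.Finite

namespace TriMap

variable {D : Type*} (M : TriMap D)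

/-- The clockwise rotation around the vertices: it sends a directed edge `e` with source `v` to the
directed edge with source `v` that follows `e` in clockwise order around `v`. The triangle
between the two is the one to the right of `e`, that is, to the left of `rev e`. -/
def rot : Equiv.Perm D := M.next * M.rev

/-- A vertex is an orbit of the rotation, identified with the set of directed edges leaving it. -/
def Vertex : Type _ := Quotient (Equiv.Perm.SameCycle.setoid M.rot)

/-- The source of a directed edge. -/
def source (e : D) : M.Vertex := Quotient.mk (Equiv.Perm.SameCycle.setoid M.rot) e

/-- The target of a directed edge. -/
def target (e : D) : M.Vertex := M.source (M.rev e)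

/-- The degree of a vertex: the number of directed edges leaving it (loops count twice). -/
noncomputable def degree (v : M.Vertex) : ℕ := {e | M.source e = v}.ncard

/-- The standard triangle, in barycentric coordinates. -/
abbrev Triangle : Type := stdSimplex ℝ (Fin 3)

/-- The identifications used to build the surface from triangles. For every directed edge `e` there
is a copy of the standard triangle, namely the triangle to the left of `e`, labelled such that
`e` goes from corner `0` to corner `1`. The three copies belonging to the same triangle are
identified by rotating the labels of the corners, and the triangles on both sides of an edge are
glued along this edge. -/
inductive Glue : (Σ _ : D, Triangle) → (Σ _ : D, Triangle) → Prop
  | rotate (e : D) (x y : Triangle) (h : ∀ i, y.1 i = x.1 (i + 1)) :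
      Glue ⟨e, x⟩ ⟨M.next e, y⟩
  | side (e : D) (x y : Triangle) (hx : x.1 2 = 0) (hy : y.1 2 = 0)
      (h₀ : y.1 0 = x.1 1) (h₁ : y.1 1 = x.1 0) :
      Glue ⟨e, x⟩ ⟨M.rev e, y⟩

/-- The surface obtained by gluing the triangles (a quotient of a disjoint union of triangles, by
the equivalence relation generated by `Glue`). -/
def Realization : Type _ := Quot M.Glue

instance : TopologicalSpace M.Realization :=
  inferInstanceAs (TopologicalSpace (Quot M.Glue))

/-- The point with parameter `t` of the side from corner `0` to corner `1` of the triangle. -/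
def sidePoint (t : unitInterval) : Triangle :=
  ⟨![1 - (t : ℝ), t, 0], by
    refine ⟨fun i => ?_, ?_⟩
    · have h0 := t.2.1
      have h1 := t.2.2
      fin_cases i <;> simp [h0, h1]
    · simp [Fin.sum_univ_three]⟩

/-- The path that traverses the directed edge `e`, in the glued surface. -/
def edgePoint (e : D) (t : unitInterval) : M.Realization := Quot.mk _ ⟨e, sidePoint t⟩

/-- Vertex `v`, between the directed edges `e` and `e'` of a walk, makes a `k`-turn. If `k ≥ 0`, this
means that `k` triangles lie to the left, between `e` and `e'`: the `k`-th directed edge after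
`rev e` in clockwise order around the vertex is `e'`. If `k < 0`, then `-k` triangles lie to the
right, between `e` and `e'`: the `-k`-th directed edge after `rev e` in counterclockwise order is
`e'`. -/
def IsTurn (k : ℤ) (e e' : D) : Prop := (M.rot ^ k) (M.rev e) = e'

/-- A closed walk, given by its number of edges and the bi-infinite periodic sequence of its
directed edges. -/
structure ClosedWalk where
  length : ℕ
  length_pos : 0 < length
  edge : ℤ → D
  periodic : ∀ i, edge (i + length) = edge i
  adjacent : ∀ i, M.target (edge i) = M.source (edge (i + 1))

/-- Closed walks are cyclic sequences: two of them are equal if they differ only in the choice of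
the starting vertex. -/
def ClosedWalk.CyclicEq {M : TriMap D} (W W' : M.ClosedWalk) : Prop :=
  W.length = W'.length ∧ ∃ k : ℤ, ∀ i, W'.edge i = W.edge (i + k)

/-! #### The closed curve of a closed walk is well-defined and continuous -/

theorem continuous_sidePoint : Continuous sidePoint := by
  refine Continuous.subtype_mk (continuous_pi fun i => ?_) _
  fin_cases i
  · exact continuous_const.sub continuous_subtype_val
  · exact continuous_subtype_val
  · exact continuous_const

theorem continuous_edgePoint (e : D) : Continuous (M.edgePoint e) :=
  continuous_quot_mk.comp (continuous_sigmaMk.comp continuous_sidePoint)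

theorem edgePoint_rev_one (e : D) : M.edgePoint (M.rev e) 1 = M.edgePoint e 0 :=
  (Quot.sound (Glue.side e (sidePoint 0) (sidePoint 1) rfl rfl
    (by simp [sidePoint]) (by simp [sidePoint]))).symm

theorem edgePoint_next_zero (e : D) : M.edgePoint (M.next e) 0 = M.edgePoint e 1 :=
  (Quot.sound (Glue.rotate e (sidePoint 1) (sidePoint 0)
    (by intro i; fin_cases i <;> simp [sidePoint]))).symm

theorem edgePoint_rot_zero (e : D) : M.edgePoint (M.rot e) 0 = M.edgePoint e 0 :=
  (M.edgePoint_next_zero (M.rev e)).trans (M.edgePoint_rev_one e)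

theorem edgePoint_zero_eq_of_source_eq {e e' : D} (h : M.source e = M.source e') :
    M.edgePoint e 0 = M.edgePoint e' 0 := by
  obtain ⟨k, rfl⟩ : M.rot.SameCycle e e' := Quotient.exact h
  induction k using Int.induction_on with
  | zero => simp
  | succ n ih =>
    rw [ih (Quotient.sound ⟨n, rfl⟩), add_comm, zpow_add, zpow_one, Equiv.Perm.mul_apply,
      edgePoint_rot_zero]
  | pred n ih =>
    rw [ih (Quotient.sound ⟨-n, rfl⟩), ← edgePoint_rot_zero M ((M.rot ^ (-(n : ℤ) - 1)) e),
      ← Equiv.Perm.mul_apply, ← zpow_one_add]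
    congr 3
    ring

theorem edgePoint_one_eq_zero {e e' : D} (h : M.target e = M.source e') :
    M.edgePoint e 1 = M.edgePoint e' 0 := by
  rw [← M.edgePoint_zero_eq_of_source_eq h, ← edgePoint_rev_one, M.rev_rev]

variable {M}

/-- The bi-infinite path that traverses the edge number `i` of the closed walk during the time
interval `[i, i + 1]`, at constant speed. -/
noncomputable def ClosedWalk.line (W : M.ClosedWalk) (s : ℝ) : M.Realization :=
  M.edgePoint (W.edge ⌊s⌋) ⟨Int.fract s, Int.fract_nonneg s, (Int.fract_lt_one s).le⟩

theorem ClosedWalk.line_eqOn (W : M.ClosedWalk) (k : ℤ) :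
    Set.EqOn W.line (fun s => M.edgePoint (W.edge k) (Set.projIcc 0 1 zero_le_one (s - k)))
      (Set.Icc (k : ℝ) (k + 1)) := by
  rintro s ⟨h0, h1⟩
  rcases h1.lt_or_eq with h1 | rfl
  · have hk : ⌊s⌋ = k := Int.floor_eq_iff.2 ⟨h0, h1⟩
    have hs : s - k ∈ Set.Icc (0 : ℝ) 1 := ⟨by linarith, by linarith⟩
    simp only [ClosedWalk.line, Int.fract, Set.projIcc_of_mem _ hs, hk]
  · have hs : (⟨Int.fract ((k : ℝ) + 1), Int.fract_nonneg _, (Int.fract_lt_one _).le⟩ :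
        unitInterval) = 0 := by
      ext; simp
    have hf : ⌊(k : ℝ) + 1⌋ = k + 1 := by simp
    simp only [ClosedWalk.line, hs, hf, add_sub_cancel_left, Set.projIcc_right]
    exact (M.edgePoint_one_eq_zero (W.adjacent k)).symm

theorem ClosedWalk.continuous_line (W : M.ClosedWalk) : Continuous W.line := by
  have hlf : LocallyFinite fun k : ℤ => Set.Icc (k : ℝ) (k + 1) :=
    locallyFinite_Icc_of_tendsto tendsto_intCast_atTop_atTop
      (Filter.tendsto_atBot_add_const_right _ _ (tendsto_intCast_atBot_iff.2 Filter.tendsto_id))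
  refine hlf.continuous ?_ (fun k => isClosed_Icc) fun k => ?_
  · refine Set.eq_univ_of_forall fun s => Set.mem_iUnion.2 ⟨⌊s⌋, Int.floor_le s, ?_⟩
    exact (Int.lt_floor_add_one s).le
  · exact (((M.continuous_edgePoint _).comp
      (continuous_projIcc.comp (continuous_id.sub continuous_const))).continuousOn).congr
      (W.line_eqOn k)

theorem ClosedWalk.line_periodic (W : M.ClosedWalk) (s : ℝ) :
    W.line (s + W.length) = W.line s := by
  have h : ⌊s + (W.length : ℝ)⌋ = ⌊s⌋ + W.length := Int.floor_add_natCast s _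
  simp only [ClosedWalk.line, h, W.periodic, Int.fract_add_natCast]

theorem ClosedWalk.periodic_line (W : M.ClosedWalk) :
    Function.Periodic (fun t : ℝ => W.line (W.length * t)) 1 := fun t => by
  simp only [mul_add, mul_one, W.line_periodic]

/-- The closed curve `ℝ / ℤ → M.Realization` that traverses the edges of the closed walk in order,
each edge during a time interval of length `1 / length`. -/
noncomputable def ClosedWalk.curve (W : M.ClosedWalk) : C(UnitAddCircle, M.Realization) where
  toFun := W.periodic_line.lift
  continuous_toFun :=
    continuous_coinduced_dom.2 (W.continuous_line.comp (continuous_const.mul continuous_id))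

end TriMap

/-- A (locally finite) triangulation of the surface `S`, oriented and without boundary: a
homeomorphism onto `S` from a space obtained by gluing triangles along their sides. Then `S`,
if connected, is automatically a surface without boundary; it is compact if and only if there are
finitely many triangles. -/
structure Triangulation (D : Type*) (S : Type*) [TopologicalSpace S] extends TriMap D where
  homeo : toTriMap.Realization ≃ₜ S

/-- The two colors of the triangles. -/
inductive Color
  | red
  | blue

/-- A reducing triangulation: the triangles are colored red and blue such that triangles that share
an edge have different colors, and every vertex has degree at least eight. -/
structure ReducingTriangulation (D : Type*) (S : Type*) [TopologicalSpace S]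
    extends Triangulation D S where
  /-- The color of the triangle to the left of a directed edge. -/
  leftColor : D → Color
  leftColor_next : ∀ e, leftColor (next e) = leftColor e
  leftColor_rev : ∀ e, leftColor (rev e) ≠ leftColor e
  eight_le_degree : ∀ v : toTriMap.Vertex, 8 ≤ toTriMap.degree v

namespace ReducingTriangulation

variable {D S : Type*} [TopologicalSpace S] (T : ReducingTriangulation D S)

/-- The closed walks in the triangulation. -/
abbrev ClosedWalk : Type _ := T.toTriMap.ClosedWalk

/-- The closed curve on the surface `S` defined by a closed walk. -/
noncomputable def closedCurve (W : T.ClosedWalk) : C(UnitAddCircle, S) :=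
  (T.homeo : C(T.toTriMap.Realization, S)).comp W.curve

/-- Two closed walks are freely homotopic if their closed curves are homotopic on `S`, through closed
curves. -/
def FreelyHomotopic (W W' : T.ClosedWalk) : Prop :=
  (T.closedCurve W).Homotopic (T.closedCurve W')

/-- A closed walk is contractible if its closed curve is freely homotopic to a constant one. -/
def Contractible (W : T.ClosedWalk) : Prop := (T.closedCurve W).Nullhomotopic

/-- The vertex between `e` and `e'` makes a `k`-turn and the triangle to the left of `e` has
color `c`. -/
def IsColoredTurn (k : ℤ) (c : Color) (e e' : D) : Prop :=
  T.toTriMap.IsTurn k e e' ∧ T.leftColor e = c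

/-- The bad turns: `0`, `1`, `-1`, `2` with red and `-2` with red. -/
def IsBadTurn (e e' : D) : Prop :=
  T.toTriMap.IsTurn 0 e e' ∨ T.toTriMap.IsTurn 1 e e' ∨ T.toTriMap.IsTurn (-1) e e' ∨
    T.IsColoredTurn 2 .red e e' ∨ T.IsColoredTurn (-2) .red e e'

/-- A closed walk is reduced if none of its vertices makes a bad turn, not all of them make a `3`-turn
with red, and not all of them make a `-3`-turn with blue. -/
def IsReduced (W : T.ClosedWalk) : Prop :=
  (∀ i, ¬ T.IsBadTurn (W.edge i) (W.edge (i + 1))) ∧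
  (¬ ∀ i, T.IsColoredTurn 3 .red (W.edge i) (W.edge (i + 1))) ∧
  (¬ ∀ i, T.IsColoredTurn (-3) .blue (W.edge i) (W.edge (i + 1)))

end ReducingTriangulation

end ReducingTri

/-! The proof combines a rewriting system with lifts to a covering surface. Words in the directed
edges (arbitrary words, not only walks) are rewritten at bad turns: a 0-turn is cancelled, a 1- or
-1-turn is replaced by the third side of its triangle, and a 2_r- or -2_r-turn is pushed across its
two triangles. This terminates and is confluent. Hence in the group presented by the directed edges
and the triangles, a word without bad turns is determined by its value
(`Irreducible.eq_of_prod_gen_eq`). The same group defines a covering of the surface, and lifting a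
free homotopy turns the two closed walks into bi-infinite lines A and B invariant under one deck
transformation (`exists_potentials`).

Suppose that some path leaves the incoming half of A and ends at the origin of B, that another one
starts at the origin of A and joins the outgoing half of B, and that neither creates a bad turn.
Following A for many periods and then the first path, or the second path and then B, gives two words
without bad turns and with the same ends. They are equal, and comparing them identifies the periods
and the edges (`exists_shift_of_reaches`).

Such paths exist because the ends of rays without bad turns that come in along A are stable under
multiplication by generators (`Ray.exists_mul`). If appending an edge creates a bad turn, the last
edge of the ray is moved across a triangle; this can force the same change on preceding edges, but
only along 3_r-turns (-3_r-turns on the other side), so it stops unless all turns of A have that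
type. A reduced walk may consist of -3_r-turns only. In that case the parallel line across the
triangles on the right, which makes only 3_r-turns, is used together with A
(`reaches_or_shift_reaches`); it is not a translate of B, since B is reduced. Reversing B yields the
path that joins B, and the remaining exceptional cases follow by exchanging or reversing the lines
(`IsReduced.exists_shift`). -/

/-- The next-and-reverse structure of a triangulation together with a sign on the directed edges
(the color of the triangle on the left), such that every vertex has more than six edges. -/
@[ext]
structure SignedMap (D : Type*) where
  next : D → D
  rev : D → D
  pos : D → Prop
  next_next_next : ∀ e, next (next (next e)) = e
  rev_rev : ∀ e, rev (rev e) = e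
  pos_next : ∀ e, pos (next e) ↔ pos e
  pos_rev : ∀ e, pos (rev e) ↔ ¬ pos e
  rot_two_ne : ∀ e, next (rev (next (rev e))) ≠ e
  rot_four_ne : ∀ e, next (rev (next (rev (next (rev (next (rev e))))))) ≠ e
  rot_six_ne : ∀ e, next (rev (next (rev (next (rev
    (next (rev (next (rev (next (rev e))))))))))) ≠ e

/-! ### Signed maps and the rewriting rules -/

namespace SignedMap

variable {D : Type*} (X : SignedMap D)

attribute [simp] next_next_next rev_rev pos_next pos_rev

theorem rev_injective : Function.Injective X.rev := fun a b h => by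
  rw [← X.rev_rev a, h, X.rev_rev]

@[simp] theorem rev_inj {a b : D} : X.rev a = X.rev b ↔ a = b := X.rev_injective.eq_iff

/-- The structure with the opposite orientation and the same signs. -/
@[simps]
def mirror : SignedMap D where
  next e := X.rev (X.next (X.next (X.rev e)))
  rev := X.rev
  pos := X.pos
  next_next_next e := by simp
  rev_rev := X.rev_rev
  pos_next e := by simp
  pos_rev := X.pos_rev
  rot_two_ne e h := X.rot_two_ne e (by conv_lhs => rw [← h]; simp)
  rot_four_ne e h := X.rot_four_ne e (by conv_lhs => rw [← h]; simp)
  rot_six_ne e h := X.rot_six_ne e (by conv_lhs => rw [← h]; simp)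

@[simp] theorem mirror_mirror : X.mirror.mirror = X := by
  ext <;> simp

/-- The replacements of two consecutive edges that bound one triangle, or two triangles the first of
which is positive, on the left. -/
inductive HalfRule : D → D → List D → Prop
  | merge (e : D) : HalfRule e (X.next e) [X.rev (X.next (X.next e))]
  | swap (e : D) (h : X.pos e) : HalfRule e (X.next (X.rev (X.next e)))
      [X.rev (X.next (X.next e)), X.rev (X.next (X.next (X.rev (X.next e))))]

/-- The replacements of two consecutive edges that make a bad turn. -/
inductive Rule : D → D → List D → Prop
  | cancel (e : D) : Rule e (X.rev e) []
  | left {e f : D} {l : List D} : X.HalfRule e f l → Rule e f l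
  | right {e f : D} {l : List D} : X.mirror.HalfRule e f l → Rule e f l

/-- Two consecutive edges that do not make a bad turn. -/
def Good (e f : D) : Prop := ∀ l, ¬ X.Rule e f l

/-- The rewriting of words. -/
inductive Step : List D → List D → Prop
  | head {e f : D} {l : List D} (b : List D) : X.Rule e f l → Step (e :: f :: b) (l ++ b)
  | tail (e : D) {u v : List D} : Step u v → Step (e :: u) (e :: v)

/-- The colors of both 2_r- and -2_r-turns refer to the triangle on the left of the first edge.
Keeping the signs while reversing the orientation therefore exchanges the two families of rules, and
every later argument is needed for one side only. -/
theorem Rule.of_mirror {e f : D} {l : List D} (h : X.mirror.Rule e f l) : X.Rule e f l := by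
  cases h with
  | cancel => exact .cancel e
  | left h => exact .right h
  | right h => exact .left (by simpa using h)

theorem rule_mirror {e f : D} {l : List D} : X.mirror.Rule e f l ↔ X.Rule e f l :=
  ⟨Rule.of_mirror X, fun h => Rule.of_mirror X.mirror (by simpa using h)⟩

theorem good_mirror {e f : D} : X.mirror.Good e f ↔ X.Good e f := by
  simp [Good, rule_mirror]

theorem Step.of_mirror {u v : List D} (h : X.mirror.Step u v) : X.Step u v := by
  induction h with
  | head b h => exact .head b (Rule.of_mirror X h)
  | tail e _ ih => exact .tail e ih

theorem step_mirror : X.mirror.Step = X.Step := by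
  ext u v
  exact ⟨Step.of_mirror X, fun h => Step.of_mirror X.mirror (by simpa using h)⟩

/-! #### Termination -/

open Classical in
/-- The number with binary digits `1` and the signs of the edges of a word. -/
noncomputable def weight (a : ℕ) (u : List D) : ℕ :=
  u.foldl (fun a e => 2 * a + if X.pos e then 1 else 0) a

theorem weight_cons (a : ℕ) (e : D) (u : List D) [Decidable (X.pos e)] :
    X.weight a (e :: u) = X.weight (2 * a + if X.pos e then 1 else 0) u := by
  unfold weight
  rw [List.foldl_cons]
  congr

theorem weight_append (a : ℕ) (u v : List D) :
    X.weight a (u ++ v) = X.weight (X.weight a u) v := List.foldl_append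

theorem weight_strictMono (u : List D) : StrictMono fun a => X.weight a u := by
  classical
  induction u with
  | nil => exact strictMono_id
  | cons e u ih =>
    intro a b h
    simp only [weight_cons]
    exact ih (by omega)

/-- A merge shortens the word. A swap keeps the length but turns the digits 10 into 01, because its
first edge is positive and the signs alternate. A positive initial value acts as a leading digit, so
that shorter words have smaller weight. -/
theorem HalfRule.weight_lt {e f : D} {l : List D} (h : X.HalfRule e f l) {a : ℕ} (ha : 0 < a) :
    X.weight a l < X.weight a [e, f] := by
  classical
  cases h with
  | merge =>
    by_cases he : X.pos e <;> simp [weight_cons, he] <;> simp [weight] <;> omega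
  | swap he =>
    simp [weight_cons, he]; simp [weight]; omega

theorem Rule.weight_lt {e f : D} {l : List D} (h : X.Rule e f l) {a : ℕ} (ha : 0 < a) :
    X.weight a l < X.weight a [e, f] := by
  classical
  cases h with
  | cancel =>
    simp only [weight_cons]; simp only [weight, List.foldl_nil]; omega
  | left h => exact h.weight_lt X ha
  | right h => exact h.weight_lt X.mirror ha

theorem Step.weight_lt {u v : List D} (h : X.Step u v) {a : ℕ} (ha : 0 < a) :
    X.weight a v < X.weight a u := by
  classical
  induction h generalizing a with
  | @head e f l b h =>
    rw [weight_append, show e :: f :: b = [e, f] ++ b from rfl, weight_append]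
    exact X.weight_strictMono b (h.weight_lt X ha)
  | tail e _ ih =>
    simp only [weight_cons]
    exact ih (by omega)

/-! #### Confluence -/

/-- Most pairs of rules are told apart by the sign of the second edge, which depends on the parity
of the turn. Two turns of equal parity coincide only if a rotation by two or four steps has a fixed
edge, which the degree excludes. -/
theorem HalfRule.unique {e f : D} {l l' : List D} (h : X.HalfRule e f l) (h' : X.Rule e f l') :
    l = l' := by
  have key : ∀ a b : D, a = b → (X.pos a ↔ X.pos b) := fun a b h => by rw [h]
  cases h with
  | merge =>
    generalize hf : X.next e = f at h'
    cases h' with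
    | cancel => simpa using key _ _ hf
    | left h' =>
      cases h' with
      | merge => rfl
      | swap => simpa using key _ _ hf
    | right h' =>
      cases h' with
      | merge =>
        exact absurd (by simpa using hf) (X.rot_two_ne (X.mirror.next e))
      | swap => simpa using key _ _ hf
  | swap he =>
    generalize hf : X.next (X.rev (X.next e)) = f at h'
    cases h' with
    | cancel => exact absurd (by simpa using hf) (X.rot_two_ne (X.rev e))
    | left h' =>
      cases h' with
      | merge => simpa using key _ _ hf
      | swap => rfl
    | right h' =>
      cases h' with
      | merge => simpa using key _ _ hf
      | swap =>
        exact absurd (by simpa using hf)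
          (X.rot_four_ne (X.mirror.next (X.rev (X.mirror.next e))))

theorem Rule.unique {e f : D} {l l' : List D} (h : X.Rule e f l) (h' : X.Rule e f l') :
    l = l' := by
  cases h with
  | left h => exact h.unique X h'
  | right h => exact h.unique X.mirror ((X.rule_mirror).2 h')
  | cancel =>
    generalize hf : X.rev e = f at h'
    cases h' with
    | cancel => rfl
    | left h' => exact (h'.unique X (hf ▸ .cancel e)).symm
    | right h' => exact (h'.unique X.mirror (hf ▸ .cancel e)).symm

/-- Two words with a common reduct. -/
def Join : List D → List D → Prop := Relation.Join (Relation.ReflTransGen X.Step)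

theorem Join.symm {u v : List D} (h : X.Join u v) : X.Join v u :=
  let ⟨w, h₁, h₂⟩ := h
  ⟨w, h₂, h₁⟩

theorem Join.step_left {u u' v : List D} (h : X.Step u u') (h' : X.Join u' v) : X.Join u v :=
  let ⟨w, h₁, h₂⟩ := h'
  ⟨w, .head h h₁, h₂⟩

theorem Join.step_right {u v v' : List D} (h : X.Step v v') (h' : X.Join u v') : X.Join u v :=
  (Join.step_left X h h'.symm).symm

theorem Join.refl (u : List D) : X.Join u u := ⟨u, .refl, .refl⟩

theorem Join.cons (e : D) {u v : List D} (h : X.Join u v) : X.Join (e :: u) (e :: v) :=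
  let ⟨w, h₁, h₂⟩ := h
  ⟨e :: w, h₁.lift _ fun _ _ => .tail e, h₂.lift _ fun _ _ => .tail e⟩

theorem Join.append_left (a : List D) {u v : List D} (h : X.Join u v) :
    X.Join (a ++ u) (a ++ v) := by
  induction a with
  | nil => exact h
  | cons e a ih => exact Join.cons X e ih

theorem Step.append_right {u v : List D} (h : X.Step u v) (b : List D) :
    X.Step (u ++ b) (v ++ b) := by
  induction h with
  | head c h => simpa using Step.head (c ++ b) h
  | tail e _ ih => exact .tail e ih

theorem Step.append_left (a : List D) {u v : List D} (h : X.Step u v) :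
    X.Step (a ++ u) (a ++ v) := by
  induction a with
  | nil => exact h
  | cons e a ih => exact .tail e ih

theorem Join.append_right {u v : List D} (h : X.Join u v) (b : List D) :
    X.Join (u ++ b) (v ++ b) :=
  let ⟨w, h₁, h₂⟩ := h
  ⟨w ++ b, h₁.lift (· ++ b) fun _ _ h => h.append_right X b,
    h₂.lift (· ++ b) fun _ _ h => h.append_right X b⟩

theorem step_cancel {e f : D} (b : List D) (h : f = X.rev e) : X.Step (e :: f :: b) b :=
  h ▸ .head b (.cancel e)

theorem step_merge {e f g : D} (b : List D) (h : f = X.next e)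
    (hg : g = X.rev (X.next (X.next e))) : X.Step (e :: f :: b) (g :: b) :=
  h ▸ hg ▸ .head b (.left (.merge e))

theorem step_merge_mirror {e f g : D} (b : List D) (h : f = X.rev (X.next (X.next (X.rev e))))
    (hg : g = X.next (X.rev e)) : X.Step (e :: f :: b) (g :: b) := by
  rw [← step_mirror]
  exact X.mirror.step_merge b h (by simp [hg])

theorem step_swap {e f g₁ g₂ : D} (b : List D) (he : X.pos e) (h : f = X.next (X.rev (X.next e)))
    (hg₁ : g₁ = X.rev (X.next (X.next e)))
    (hg₂ : g₂ = X.rev (X.next (X.next (X.rev (X.next e))))) :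
    X.Step (e :: f :: b) (g₁ :: g₂ :: b) :=
  h ▸ hg₁ ▸ hg₂ ▸ .head b (.left (.swap e he))

theorem step_swap_mirror {e f g₁ g₂ : D} (b : List D) (he : X.pos e)
    (h : f = X.rev (X.next (X.next (X.rev (X.next (X.next (X.rev e)))))))
    (hg₁ : g₁ = X.next (X.rev e)) (hg₂ : g₂ = X.next (X.rev (X.next (X.next (X.rev e))))) :
    X.Step (e :: f :: b) (g₁ :: g₂ :: b) := by
  rw [← step_mirror]
  exact X.mirror.step_swap b he (by simp [h]) (by simp [hg₁]) (by simp [hg₂])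

/-- These are the critical pairs: three edges with bad turns at both inner vertices. Each is
resolved by at most two steps on each side. -/
theorem HalfRule.join {e f g : D} {l l' : List D} (h : X.HalfRule e f l) (h' : X.Rule f g l') :
    X.Join (l ++ [g]) (e :: l') := by
  cases h with
  | merge =>
    generalize hf : X.next e = f at h'
    cases h' with
    | cancel =>
      subst hf
      exact .step_left X (X.step_merge_mirror [] (by simp) (by simp)) (.refl X _)
    | left h' =>
      subst hf
      cases h' with
      | merge =>
        exact .step_left X (X.step_cancel [] (by simp))
          (.step_right X (X.step_cancel [] (by simp)) (.refl X _))
      | swap =>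
        exact .step_left X (X.step_merge [] (by simp) rfl)
          (.step_right X (X.step_cancel _ (by simp)) (by simpa using Join.refl X _))
    | right h' =>
      subst hf
      cases h' with
      | merge =>
        -- The two reducts run along opposite sides of one pair of triangles; the sign of `e`
        -- decides which of them is swapped into the other.
        by_cases he : X.pos e
        · exact .step_right X (X.step_swap [] he (by simp) rfl rfl)
            (by simpa using Join.refl X _)
        · exact .step_left X (X.step_swap_mirror [] (by simpa using he) (by simp) rfl rfl)
            (by simpa using Join.refl X _)
      | swap he =>
        exact .step_right X (X.step_swap _ (by simpa using he) (by simp) rfl rfl)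
          (.step_right X (.tail _ (X.step_merge [] (by simp) rfl)) (by simpa using Join.refl X _))
  | swap he =>
    generalize hf : X.next (X.rev (X.next e)) = f at h'
    cases h' with
    | cancel =>
      subst hf
      exact .step_left X (.tail _ (X.step_merge_mirror [] (by simp) rfl))
        (.step_left X (X.step_merge_mirror [] (by simp) rfl) (by simpa using Join.refl X _))
    | left h' =>
      subst hf
      cases h' with
      | merge =>
        exact .step_left X (.tail _ (X.step_cancel [] (by simp)))
          (.step_right X (X.step_merge [] (by simp) rfl) (by simpa using Join.refl X _))
      -- The second edge of a swap is negative, so two swaps never overlap.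
      | swap hf => simp [he] at hf
    | right h' =>
      subst hf
      cases h' with
      | merge =>
        exact .step_left X (.tail _ (X.step_swap_mirror [] (by simp [he]) (by simp) rfl rfl))
          (.step_left X (X.step_merge_mirror _ (by simp) rfl) (by simpa using Join.refl X _))
      | swap hf => simp [he] at hf

theorem Rule.join {e f g : D} {l l' : List D} (h : X.Rule e f l) (h' : X.Rule f g l') :
    X.Join (l ++ [g]) (e :: l') := by
  have cancel_left : ∀ (X : SignedMap D) (e g : D) (l' : List D), X.HalfRule (X.rev e) g l' →
      X.Join [g] (e :: l') := fun X e g l' h' => by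
    generalize hf : X.rev e = f at h'
    obtain rfl : e = X.rev f := by simp [← hf]
    cases h' with
    | merge =>
      exact .step_right X (X.step_merge_mirror [] (by simp) rfl) (by simpa using Join.refl X _)
    | swap =>
      exact .step_right X (X.step_merge_mirror _ (by simp) rfl)
        (.step_right X (X.step_merge_mirror [] (by simp) rfl) (by simpa using Join.refl X _))
  have join_mirror : X.mirror.Join = X.Join := by simp [Join, step_mirror]
  cases h with
  | left h => exact h.join X h'
  | right h => exact join_mirror ▸ h.join X.mirror (X.rule_mirror.2 h')
  | cancel =>
    generalize hf : X.rev e = f at h'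
    cases h' with
    | cancel => subst hf; simpa using Join.refl X _
    | left h' => exact cancel_left X _ _ _ (hf ▸ h')
    | right h' => exact join_mirror ▸ cancel_left X.mirror _ _ _ (by simpa [hf] using h')

theorem Step.join {u v w : List D} (h : X.Step u v) (h' : X.Step u w) : X.Join v w := by
  have key : ∀ {e f : D} {l b w : List D}, X.Rule e f l → X.Step (f :: b) w →
      X.Join (l ++ b) (e :: w) := fun {e f l b w} h h' => by
    cases h' with
    | head b h' => simpa using (h.join X h').append_right X b
    | tail _ h' =>
      exact .step_left X (h'.append_left X l) (.step_right X (.head _ h) (.refl X _))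
  induction h generalizing w with
  | head b h =>
    cases h' with
    | head _ h' => rw [h.unique X h']; exact .refl X _
    | tail _ h' => exact key h h'
  | tail e h ih =>
    cases h' with
    | head b h' => exact (key h' h).symm
    | tail _ h' => exact (ih h').cons X e

/-- Newman's lemma, by induction on the weight. -/
theorem confluent {u v w : List D} (h : Relation.ReflTransGen X.Step u v)
    (h' : Relation.ReflTransGen X.Step u w) : X.Join v w := by
  induction hn : X.weight 1 u using Nat.strong_induction_on generalizing u v w with
  | _ n ih =>
    subst hn
    rcases h.cases_head with rfl | ⟨v₁, hv₁, hv⟩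
    · exact ⟨w, h', .refl⟩
    rcases h'.cases_head with rfl | ⟨w₁, hw₁, hw⟩
    · exact ⟨v, .refl, h⟩
    obtain ⟨x, hvx, hwx⟩ := hv₁.join X hw₁
    obtain ⟨y, hvy, hxy⟩ := ih _ (hv₁.weight_lt X one_pos) hv hvx rfl
    obtain ⟨z, hyz, hwz⟩ := ih _ (hw₁.weight_lt X one_pos) (hwx.trans hxy) hw rfl
    exact ⟨z, hvy.trans hyz, hwz⟩

theorem Join.trans {u v w : List D} (h : X.Join u v) (h' : X.Join v w) : X.Join u w := by
  obtain ⟨x, hux, hvx⟩ := h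
  obtain ⟨y, hvy, hwy⟩ := h'
  obtain ⟨z, hxz, hyz⟩ := X.confluent hvx hvy
  exact ⟨z, hux.trans hxz, hwy.trans hyz⟩

/-- A word none of whose turns is bad. -/
def Irreducible (u : List D) : Prop := u.IsChain X.Good

theorem Irreducible.not_step {u v : List D} (h : X.Irreducible u) : ¬ X.Step u v := by
  intro h'
  induction h' with
  | head b h' => exact (List.isChain_cons_cons.1 h).1 _ h'
  | tail e _ ih => exact ih h.tail

theorem Irreducible.eq_of_join {u v : List D} (hu : X.Irreducible u) (hv : X.Irreducible v)
    (h : X.Join u v) : u = v := by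
  obtain ⟨w, hu', hv'⟩ := h
  rcases hu'.cases_head with rfl | ⟨u₁, h, -⟩
  · rcases hv'.cases_head with rfl | ⟨v₁, h, -⟩
    · rfl
    · exact absurd h (hv.not_step X)
  · exact absurd h (hu.not_step X)

/-! #### The group presented by the triangles -/

/-- The congruence of words with a common reduct. -/
def wordCon : Con (FreeMonoid D) where
  r u v := X.Join u.toList v.toList
  iseqv := ⟨fun u => .refl X _, fun h => h.symm, fun h h' => h.trans X h'⟩
  mul' {u v u' v'} h h' := by
    simpa using (h.append_right X u'.toList).trans X (h'.append_left X v.toList)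

/-- The group generated by the directed edges, in which the product of the sides of a triangle is
trivial. -/
abbrev EdgeGroup : Type _ := (X.wordCon.Quotient)ˣ

/-- The class of a word. -/
def wordClass : FreeMonoid D →* X.wordCon.Quotient := X.wordCon.mk'

theorem wordClass_eq_iff {u v : List D} :
    X.wordClass (FreeMonoid.ofList u) = X.wordClass (FreeMonoid.ofList v) ↔ X.Join u v :=
  X.wordCon.eq

theorem wordClass_eq_of_step {u v : List D} (h : X.Step u v) :
    X.wordClass (FreeMonoid.ofList u) = X.wordClass (FreeMonoid.ofList v) :=
  X.wordClass_eq_iff.2 (.step_left X h (.refl X v))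

/-- The generator of the group that corresponds to a directed edge. -/
def gen (e : D) : X.EdgeGroup where
  val := X.wordClass (FreeMonoid.ofList [e])
  inv := X.wordClass (FreeMonoid.ofList [X.rev e])
  val_inv := by
    rw [← map_mul]
    exact X.wordClass_eq_of_step (X.step_cancel [] rfl)
  inv_val := by
    rw [← map_mul]
    exact X.wordClass_eq_of_step (X.step_cancel [] (by simp))

theorem val_prod_gen (u : List D) :
    ((u.map X.gen).prod : X.wordCon.Quotient) = X.wordClass (FreeMonoid.ofList u) := by
  induction u with
  | nil => rfl
  | cons e u ih =>
    rw [List.map_cons, List.prod_cons, Units.val_mul, ih, ← List.singleton_append,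
      FreeMonoid.ofList_append, map_mul]
    rfl

theorem exists_eq_prod_gen (p : X.EdgeGroup) : ∃ u : List D, p = (u.map X.gen).prod := by
  obtain ⟨u, hu⟩ := X.wordCon.mk'_surjective p.val
  exact ⟨u.toList, Units.ext ((X.val_prod_gen u.toList).trans hu).symm⟩

/-- Equality in the group means a common reduct, and an irreducible word has no reduct but itself.
-/
theorem Irreducible.eq_of_prod_gen_eq {u v : List D} (hu : X.Irreducible u)
    (hv : X.Irreducible v) (h : (u.map X.gen).prod = (v.map X.gen).prod) : u = v := by
  refine hu.eq_of_join X hv (X.wordClass_eq_iff.1 ?_)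
  rw [← val_prod_gen, ← val_prod_gen, h]

/-- A map to a group that is compatible with reversal and with the triangles. -/
structure IsLabeling {G : Type*} [Group G] (g : D → G) : Prop where
  rev : ∀ e, g (X.rev e) = (g e)⁻¹
  triangle : ∀ e, g e * g (X.next e) * g (X.next (X.next e)) = 1

theorem isLabeling_gen : X.IsLabeling X.gen where
  rev e := Units.ext rfl
  triangle e := by
    have h := X.wordClass_eq_of_step (X.step_merge [X.next (X.next e)] (e := e) rfl rfl)
    have h' := X.wordClass_eq_of_step
      (X.step_cancel [] (e := X.rev (X.next (X.next e))) (X.rev_rev _).symm)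
    have h₁ := X.val_prod_gen [e, X.next e, X.next (X.next e)]
    have h₂ := X.val_prod_gen []
    refine Units.ext ?_
    rw [h, h', ← h₂] at h₁
    simpa [mul_assoc] using h₁

end SignedMap

/-! ### Moving the edges of a ray across triangles -/

namespace SignedMap

variable {D : Type*} (X : SignedMap D)

/-- The edge that follows `e` after a turn with three triangles on the left. -/
def turnThree (e : D) : D := X.next (X.rev (X.next (X.rev (X.next e))))

/-- The first edge of the path that passes on the other side of the two triangles between `e` and the
edge that follows `e` after a turn with two triangles on the left. -/
def shiftFst (e : D) : D := X.rev (X.next (X.next e))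

/-- The second edge of the path that passes on the other side of the two triangles between `e` and
the edge that follows `e` after a turn with two triangles on the left. -/
def shiftSnd (e : D) : D := X.rev (X.next (X.next (X.rev (X.next e))))

theorem good_iff {e f : D} : X.Good e f ↔ f ≠ X.rev e ∧ f ≠ X.next e ∧ f ≠ X.mirror.next e ∧
    (X.pos e → f ≠ X.next (X.rev (X.next e))) ∧
    (X.pos e → f ≠ X.mirror.next (X.rev (X.mirror.next e))) := by
  constructor
  · refine fun h => ⟨?_, ?_, ?_, fun he => ?_, fun he => ?_⟩ <;> rintro rfl
    · exact h _ (.cancel e)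
    · exact h _ (.left (.merge e))
    · exact h _ (.right (.merge e))
    · exact h _ (.left (.swap e he))
    · exact h _ (.right (.swap e he))
  · rintro ⟨h₁, h₂, h₃, h₄, h₅⟩ l h
    cases h with
    | cancel => exact h₁ rfl
    | left h =>
      cases h with
      | merge => exact h₂ rfl
      | swap he => exact h₄ he rfl
    | right h =>
      cases h with
      | merge => exact h₃ rfl
      | swap he => exact h₅ he rfl

theorem ne_of_pos_iff {e f : D} (h : X.pos e ↔ ¬ X.pos f) : e ≠ f := by
  rintro rfl
  exact iff_not_self h

/-- The signs exclude the even bad turns, and the degree excludes the 1- and -1-turns. -/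
theorem good_turnThree (e : D) : X.Good e (X.turnThree e) := by
  refine X.good_iff.2 ⟨X.ne_of_pos_iff (by simp [turnThree]), fun h => ?_, fun h => ?_,
    fun _ => X.ne_of_pos_iff (by simp [turnThree]), fun _ => X.ne_of_pos_iff (by simp [turnThree])⟩
  · exact X.rot_two_ne _ h
  · refine X.rot_four_ne (X.mirror.next e) ?_
    conv_rhs => rw [← h]
    simp [turnThree]

theorem good_shiftFst_shiftSnd {e : D} (he : X.pos e) : X.Good (X.shiftFst e) (X.shiftSnd e) := by
  refine X.good_iff.2 ⟨fun h => ?_, X.ne_of_pos_iff (by simp [shiftFst, shiftSnd]),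
    X.ne_of_pos_iff (by simp [shiftFst, shiftSnd]),
    fun h => by simp [shiftFst, he] at h, fun h => by simp [shiftFst, he] at h⟩
  refine X.rot_two_ne (X.shiftSnd e) ?_
  conv_rhs => rw [h]
  simp [shiftFst, shiftSnd]

theorem turnThree_ne_mirror_turnThree (e : D) : X.turnThree e ≠ X.mirror.turnThree e := by
  intro h
  refine X.rot_six_ne (X.mirror.turnThree e) ?_
  conv_rhs => rw [← h]
  simp [turnThree]

/-- Replacing `f` by `shiftFst f` turns a k-turn into a (k-1)-turn. From a good turn this is bad
only for a 2_b-turn, which becomes a 1-turn, and for a 3_r-turn, which becomes a 2_r-turn. -/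
theorem Good.shiftFst {e f : D} (h : X.Good e f) (h₂ : X.pos e ∨ f ≠ X.next (X.rev (X.next e)))
    (h₃ : ¬ X.pos e ∨ f ≠ X.turnThree e) : X.Good e (X.shiftFst f) := by
  have key : ∀ f', X.shiftFst f = f' → f = X.next (X.rev f') := fun f' h => by
    rw [← h]; simp [SignedMap.shiftFst]
  obtain ⟨h0, h1, h1', h2, h2'⟩ := X.good_iff.1 h
  refine X.good_iff.2 ⟨fun h => h1 ?_, fun h => ?_, fun h => h0 ?_, fun he h => ?_, fun he h => ?_⟩
  · simpa using key _ h
  · have := key _ h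
    by_cases he : X.pos e
    · exact h2 he this
    · exact (h₂.resolve_left he) this
  · simpa using key _ h
  · exact (h₃.resolve_left (not_not.2 he)) (key _ h)
  · exact h1' (by simpa using key _ h)

section Labeling

variable {X} {G : Type*} [Group G] {g : D → G}

theorem IsLabeling.next_next (hg : X.IsLabeling g) (e : D) :
    g (X.next (X.next e)) = (g (X.next e))⁻¹ * (g e)⁻¹ := by
  have := hg.triangle e
  rw [eq_comm, ← mul_inv_rev, eq_comm]
  exact eq_inv_of_mul_eq_one_right this

theorem IsLabeling.mirror (hg : X.IsLabeling g) : X.mirror.IsLabeling g where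
  rev := hg.rev
  triangle e := by simp [hg.rev, hg.next_next]

theorem IsLabeling.shiftFst (hg : X.IsLabeling g) (e : D) :
    g (X.shiftFst e) = g e * g (X.next e) := by
  simp [SignedMap.shiftFst, hg.rev, hg.next_next]

theorem IsLabeling.shiftSnd (hg : X.IsLabeling g) (e : D) :
    g (X.shiftSnd e) = (g (X.next e))⁻¹ * g (X.next (X.rev (X.next e))) := by
  simp [SignedMap.shiftSnd, hg.rev, hg.next_next]

theorem IsLabeling.shiftFst_mul_shiftSnd (hg : X.IsLabeling g) (e : D) :
    g (X.shiftFst e) * g (X.shiftSnd e) = g e * g (X.shiftFst (X.turnThree e)) := by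
  rw [show X.shiftFst (X.turnThree e) = X.next (X.rev (X.next e)) by
    simp [SignedMap.shiftFst, turnThree], hg.shiftFst, hg.shiftSnd]
  group

end Labeling

/-! #### Reduced rays -/

section Ray

variable {G : Type*} [Group G] (g : D → G) (B : G → D → Prop)

/-- `Ray g B p a` means that the element `p` is the end of a ray with last edge `a`, all of whose
turns are good; the given relation `B` describes such rays, and further edges may be appended. -/
inductive Ray : G → D → Prop
  | base {p : G} {a : D} : B p a → Ray p a
  | step {p : G} {b a : D} : Ray p b → X.Good b a → Ray (p * g a) a

theorem ray_mirror : X.mirror.Ray g B = X.Ray g B := by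
  have key : ∀ (X : SignedMap D) p a, X.mirror.Ray g B p a → X.Ray g B p a := fun X p a h => by
    induction h with
    | base h => exact .base h
    | step _ h ih => exact .step ih (X.good_mirror.1 h)
  ext p a
  exact ⟨key X p a, fun h => key X.mirror p a (by simpa using h)⟩

/-- For a ray that ends with `a` at the point `p`, the replacement of the last edge by `shiftFst a`
results in a ray to which `shiftSnd a` can be appended. -/
def Shiftable (p : G) (a : D) : Prop :=
  ∃ a', X.Ray g B (p * (g a)⁻¹ * g (X.shiftFst a)) a' ∧
    (a' = X.shiftFst a ∨ X.pos a' ∧ X.shiftSnd a = X.mirror.turnThree a')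

/-- The rays of `B` can be traced back. -/
def Extendable : Prop := ∀ p a, B p a → ∃ q b, B q b ∧ X.Good b a ∧ p = q * g a

variable {X g B}

theorem Extendable.exists_ray (hB : X.Extendable g B) {p : G} {a : D} (h : X.Ray g B p a) :
    ∃ q b, X.Ray g B q b ∧ X.Good b a ∧ p = q * g a := by
  cases h with
  | base h =>
    obtain ⟨q, b, hq, hb, hp⟩ := hB _ _ h
    exact ⟨q, b, .base hq, hb, hp⟩
  | @step q b _ h hb => exact ⟨q, b, h, hb, rfl⟩

/-- Moving `a` across the triangle on its left decreases the turn between `b` and `a` by one. Only a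
3_r-turn makes it necessary to shift `b` by the same procedure, which is the recursive hypothesis.
-/
theorem Extendable.shiftable (hB : X.Extendable g B) (hg : X.IsLabeling g) {p : G} {a b : D}
    (hp : X.Ray g B p b) (hb : X.Good b a) (ha : X.pos a)
    (h : X.pos b → a = X.turnThree b → X.Shiftable g B p b) : X.Shiftable g B (p * g a) a := by
  unfold Shiftable
  rw [mul_inv_cancel_right]
  -- After a 3_r-turn, shift `b` too and continue with `shiftSnd b`. The shifted path then makes a
  -- -3_r-turn towards `shiftSnd a`.
  by_cases h₃ : a = X.turnThree b
  · subst h₃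
    have hb' : X.pos b := by simpa [turnThree] using ha
    obtain ⟨a', ha', h'⟩ := h hb' rfl
    refine ⟨X.shiftSnd b, ?_, .inr ⟨by simpa [shiftSnd] using hb', by
      simp [shiftSnd, turnThree]⟩⟩
    have hgood : X.Good a' (X.shiftSnd b) := by
      rcases h' with rfl | ⟨-, h'⟩
      · exact X.good_shiftFst_shiftSnd hb'
      · rw [h', ← X.good_mirror]
        exact X.mirror.good_turnThree a'
    convert! ha'.step hgood using 1
    rw [mul_assoc _ (g _), hg.shiftFst_mul_shiftSnd]
    group
  -- After a 2_b-turn the shifted edge is `next b`; it merges with `b` into `shiftFst b`. Since `b`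
  -- is negative, the turn before it is neither 2_b nor 3_r, so nothing propagates further.
  by_cases h₂ : ¬ X.pos b ∧ a = X.next (X.rev (X.next b))
  · obtain ⟨hb', rfl⟩ := h₂
    obtain ⟨q, c, hq, hc, rfl⟩ := hB.exists_ray hp
    refine ⟨X.shiftFst b, ?_, .inr ⟨by simpa [shiftFst] using hb', by
      simp [shiftFst, shiftSnd, turnThree]⟩⟩
    have hgood : X.Good c (X.shiftFst b) := hc.shiftFst X
      (or_iff_not_imp_left.2 fun h h' => hb' (by simpa [h'] using h))
      (or_iff_not_imp_left.2 fun h h' => hb' (by simpa [h', turnThree] using h))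
    convert! hq.step hgood using 1
    rw [show X.shiftFst (X.next (X.rev (X.next b))) = X.next b by simp [shiftFst], hg.shiftFst]
    group
  · exact ⟨_, hp.step (hb.shiftFst X (by tauto) (by tauto)), .inl rfl⟩

theorem Ray.shiftable (hB : X.Extendable g B) (hg : X.IsLabeling g)
    (hs : ∀ p a, B p a → X.pos a → X.Shiftable g B p a) {p : G} {a : D} (h : X.Ray g B p a)
    (ha : X.pos a) : X.Shiftable g B p a := by
  induction h with
  | base h => exact hs _ _ h ha
  | step h hb ih => exact hB.shiftable hg h hb ha fun hb _ => ih hb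

/-- For a merge the new end is that of the shifted ray. If the last edge is negative, shifting it
alone suffices, since a 2_b- or 3_r-turn before it would make it positive. For a swap, `shiftSnd` is
appended to the shifted ray. -/
theorem Ray.exists_mul_of_halfRule (hB : X.Extendable g B) (hg : X.IsLabeling g)
    (hs : ∀ p a, B p a → X.pos a → X.Shiftable g B p a) {p : G} {a e : D} {l : List D}
    (h : X.Ray g B p a) (he : X.HalfRule a e l) : ∃ a', X.Ray g B (p * g e) a' := by
  cases he with
  | merge =>
    by_cases ha : X.pos a
    · obtain ⟨a', h', -⟩ := h.shiftable hB hg hs ha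
      refine ⟨a', ?_⟩
      rwa [hg.shiftFst, mul_assoc, inv_mul_cancel_left] at h'
    · obtain ⟨q, b, hq, hb, rfl⟩ := hB.exists_ray h
      have hb' : X.Good b (X.shiftFst a) := hb.shiftFst X
        (or_iff_not_imp_right.2 fun h => by simpa [not_not.1 h] using ha)
        (or_iff_not_imp_right.2 fun h => by simpa [not_not.1 h, turnThree] using ha)
      refine ⟨X.shiftFst a, ?_⟩
      have := hq.step hb'
      rwa [hg.shiftFst, ← mul_assoc] at this
  | swap ha =>
    obtain ⟨a', h', h''⟩ := h.shiftable hB hg hs ha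
    have hgood : X.Good a' (X.shiftSnd a) := by
      rcases h'' with rfl | ⟨-, h'⟩
      · exact X.good_shiftFst_shiftSnd ha
      · rw [h', ← X.good_mirror]
        exact X.mirror.good_turnThree a'
    refine ⟨X.shiftSnd a, ?_⟩
    convert! h'.step hgood using 1
    rw [hg.shiftFst, hg.shiftSnd]
    group

theorem Ray.exists_mul (hB : X.Extendable g B) (hg : X.IsLabeling g)
    (hs : ∀ p a, B p a → X.pos a → X.Shiftable g B p a)
    (hs' : ∀ p a, B p a → X.pos a → X.mirror.Shiftable g B p a) {p : G} {a : D}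
    (h : X.Ray g B p a) (e : D) : ∃ a', X.Ray g B (p * g e) a' := by
  by_cases he : X.Good a e
  · exact ⟨e, h.step he⟩
  obtain ⟨l, hl⟩ : ∃ l, X.Rule a e l := by simpa [Good] using he
  cases hl with
  | cancel =>
    obtain ⟨q, b, hq, -, rfl⟩ := hB.exists_ray h
    exact ⟨b, by simpa [hg.rev] using hq⟩
  | left hl => exact h.exists_mul_of_halfRule hB hg hs hl
  | right hl =>
    rw [← ray_mirror] at h ⊢
    refine h.exists_mul_of_halfRule (fun p a h => ?_) hg.mirror hs' hl
    simpa [good_mirror] using hB p a h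

end Ray

end SignedMap

/-! ### Periodic lines and the rays that leave them -/

namespace SignedMap

variable {D : Type*} {X : SignedMap D} {G : Type*} [Group G] {g : D → G}

variable (X g) in
/-- A periodic bi-infinite sequence of directed edges all of whose turns are good, lifted to a
sequence that is invariant under the translation by `deck`: `pot i` is the element of the group
that corresponds to the source of the edge number `i`. -/
structure Axis where
  deck : G
  length : ℕ
  length_pos : 0 < length
  edge : ℤ → D
  pot : ℤ → G
  periodic : ∀ i, edge (i + length) = edge i
  good : ∀ i, X.Good (edge i) (edge (i + 1))
  pot_add_one : ∀ i, pot (i + 1) = pot i * g (edge i)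
  pot_add_length : ∀ i, pot (i + length) = deck * pot i

namespace Axis

variable (A : Axis X g)

theorem edge_add_mul (i k : ℤ) : A.edge (i + k * A.length) = A.edge i := by
  have h : Function.Periodic A.edge A.length := A.periodic
  simpa using h.int_mul k i

theorem pot_add_mul (i k : ℤ) : A.pot (i + k * A.length) = A.deck ^ k * A.pot i := by
  induction k using Int.induction_on with
  | zero => simp
  | succ n ih =>
    rw [show i + (n + 1 : ℤ) * A.length = i + n * A.length + A.length by ring, A.pot_add_length, ih,
      ← mul_assoc, ← zpow_one_add, add_comm]
  | pred n ih =>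
    rw [← mul_right_inj A.deck, ← A.pot_add_length, ← mul_assoc, ← zpow_one_add, add_sub_cancel,
      ← ih]
    congr 1
    ring

theorem exists_le_of_not_forall {P : D → D → Prop} (h : ¬ ∀ i, P (A.edge i) (A.edge (i + 1)))
    (i : ℤ) : ∃ j ≤ i, ¬ P (A.edge j) (A.edge (j + 1)) := by
  obtain ⟨j, hj⟩ := not_forall.1 h
  have hL : (1 : ℤ) ≤ A.length := by exact_mod_cast A.length_pos
  -- Going back |j - i| periods, each of length at least one, leads from `j` to an index at most
  -- `i`.
  refine ⟨j + (-|j - i|) * A.length, ?_, ?_⟩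
  · have h1 : |j - i| * 1 ≤ |j - i| * A.length := mul_le_mul_of_nonneg_left hL (abs_nonneg _)
    have h2 := le_abs_self (j - i)
    linarith
  · rwa [add_right_comm, edge_add_mul, edge_add_mul]

/-- The word formed by `n` consecutive edges. -/
def segment (i : ℤ) (n : ℕ) : List D := (List.range n).map fun k : ℕ => A.edge (i + k)

@[simp] theorem length_segment (i : ℤ) (n : ℕ) : (A.segment i n).length = n := by
  simp [segment]

theorem segment_succ (i : ℤ) (n : ℕ) :
    A.segment i (n + 1) = A.segment i n ++ [A.edge (i + n)] := by
  simp [segment, List.range_succ]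

theorem segment_succ' (i : ℤ) (n : ℕ) :
    A.segment i (n + 1) = A.edge i :: A.segment (i + 1) n := by
  simp only [segment, List.range_succ_eq_map, List.map_cons, List.map_map, Nat.cast_zero, add_zero]
  congr 2
  ext k
  simp only [Function.comp_apply, Nat.succ_eq_add_one]
  congr 1
  push_cast
  ring

theorem pot_mul_prod_segment (i : ℤ) (n : ℕ) :
    A.pot i * ((A.segment i n).map g).prod = A.pot (i + n) := by
  induction n with
  | zero => simp [segment]
  | succ n ih =>
    rw [segment_succ, List.map_append, List.prod_append, ← mul_assoc, ih]
    simp [← A.pot_add_one, add_assoc]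

/-- The group element `p` can be reached from the axis by a word that forms a reduced ray with the
incoming part of the axis. -/
def Reaches (p : G) : Prop :=
  ∃ i w, p = A.pot i * (w.map g).prod ∧ X.Irreducible (A.edge (i - 1) :: w)

/-- The axis can be reached from the group element `p` by a word that forms a reduced ray with the
outgoing part of the axis. -/
def ReachedFrom (p : G) : Prop :=
  ∃ i w, p * (w.map g).prod = A.pot i ∧ X.Irreducible (w ++ [A.edge i])

theorem irreducible_segment_append {i : ℤ} {w : List D}
    (h : X.Irreducible (A.edge (i - 1) :: w)) (n : ℕ) :
    X.Irreducible (A.segment (i - n) n ++ w) := by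
  suffices ∀ n : ℕ, X.Irreducible (A.segment (i - (n + 1 : ℕ)) (n + 1) ++ w) by
    cases n with
    | zero => exact h.tail
    | succ n => exact this n
  intro n
  induction n with
  | zero => simpa [segment] using h
  | succ n ih =>
    rw [segment_succ', List.cons_append, show i - (n + 1 + 1 : ℕ) + 1 = i - (n + 1 : ℕ) by
      push_cast; ring]
    rw [segment_succ', List.cons_append] at ih ⊢
    refine List.isChain_cons_cons.2 ⟨?_, ih⟩
    convert! A.good _ using 2
    push_cast; ring

theorem irreducible_append_segment {i : ℤ} {w : List D}
    (h : X.Irreducible (w ++ [A.edge i])) (n : ℕ) :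
    X.Irreducible (w ++ A.segment i n) := by
  suffices ∀ n : ℕ, X.Irreducible (w ++ A.segment i (n + 1)) by
    cases n with
    | zero => simpa [segment, Irreducible] using h.left_of_append
    | succ n => exact this n
  intro n
  induction n with
  | zero => simpa [segment] using h
  | succ n ih =>
    rw [segment_succ, ← List.append_assoc]
    rw [segment_succ] at ih ⊢
    refine List.isChain_append.2 ⟨ih, List.isChain_singleton _, ?_⟩
    simpa [add_assoc] using A.good (i + n)

/-- The relation for rays that consist of edges of the axis. -/
def IsEnd (p : G) (a : D) : Prop := ∃ i, p = A.pot (i + 1) ∧ a = A.edge i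

theorem IsEnd.exists_isEnd {p : G} {a : D} (h : A.IsEnd p a) :
    ∃ q b, A.IsEnd q b ∧ X.Good b a ∧ p = q * g a := by
  obtain ⟨i, rfl, rfl⟩ := h
  refine ⟨A.pot i, A.edge (i - 1), ⟨i - 1, by simp, rfl⟩, ?_, A.pot_add_one i⟩
  simpa using A.good (i - 1)

theorem reaches_of_ray {B : G → D → Prop} {ι : Type*} (A : ι → Axis X g)
    (hB : ∀ p a, B p a → ∃ k, (A k).IsEnd p a) {p : G} {a : D} (h : X.Ray g B p a) :
    ∃ k, (A k).Reaches p := by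
  -- The last letter is carried along in the induction, since the turn at the next edge depends on
  -- it.
  suffices ∃ k i w, p = (A k).pot i * (w.map g).prod ∧
      X.Irreducible ((A k).edge (i - 1) :: w) ∧ ((A k).edge (i - 1) :: w).getLast? = some a by
    obtain ⟨k, i, w, h₁, h₂, -⟩ := this
    exact ⟨k, i, w, h₁, h₂⟩
  induction h with
  | base h =>
    obtain ⟨k, i, rfl, rfl⟩ := hB _ _ h
    exact ⟨k, i + 1, [], by simp, List.isChain_singleton _, by simp⟩
  | @step q b a _ hb ih =>
    obtain ⟨k, i, w, rfl, h₂, h₃⟩ := ih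
    refine ⟨k, i, w ++ [a], by simp [mul_assoc], ?_, by
      rw [← List.cons_append, List.getLast?_concat]⟩
    rw [← List.cons_append]
    refine List.isChain_append.2 ⟨h₂, List.isChain_singleton _, ?_⟩
    rw [h₃]
    simpa using hb

theorem ray_mul_prod {B : G → D → Prop} (hB : X.Extendable g B) (hg : X.IsLabeling g)
    (hs : ∀ p a, B p a → X.pos a → X.Shiftable g B p a)
    (hs' : ∀ p a, B p a → X.pos a → X.mirror.Shiftable g B p a) {p : G} {a : D}
    (h : X.Ray g B p a) (w : List D) : ∃ a', X.Ray g B (p * (w.map g).prod) a' := by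
  induction w generalizing p a with
  | nil => exact ⟨a, by simpa using h⟩
  | cons e w ih =>
    obtain ⟨a', h'⟩ := h.exists_mul hB hg hs hs' e
    simpa [mul_assoc] using ih h'

/-- The axis, as an axis for the opposite orientation. -/
@[simps]
def mirror : Axis X.mirror g where
  __ := A
  good i := X.good_mirror.2 (A.good i)

theorem shiftable_of_exists_le {B : G → D → Prop} (hB : X.Extendable g B) (hg : X.IsLabeling g)
    (hA : ∀ p a, A.IsEnd p a → B p a)
    (h : ∀ i, ∃ j ≤ i, ¬ (X.pos (A.edge j) ∧ A.edge (j + 1) = X.turnThree (A.edge j)))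
    {p : G} {a : D} (hp : A.IsEnd p a) (ha : X.pos a) : X.Shiftable g B p a := by
  obtain ⟨i, rfl, rfl⟩ := hp
  -- The turn after edge `j` is not a 3_r-turn, so shifting edge `j + 1` does not propagate; from
  -- there the induction goes forward to `i`.
  obtain ⟨j, hj, h⟩ := h (i - 1)
  obtain ⟨n, rfl⟩ : ∃ n : ℕ, i = j + 1 + n := ⟨(i - 1 - j).toNat, by omega⟩
  clear hj
  have hstep : ∀ i, X.pos (A.edge (i + 1)) → (X.pos (A.edge i) →
      A.edge (i + 1) = X.turnThree (A.edge i) → X.Shiftable g B (A.pot (i + 1)) (A.edge i)) →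
      X.Shiftable g B (A.pot (i + 1 + 1)) (A.edge (i + 1)) := fun i ha h => by
    rw [A.pot_add_one (i + 1)]
    exact hB.shiftable hg (.base (hA _ _ ⟨i, rfl, rfl⟩)) (A.good i) ha h
  induction n with
  | zero =>
    simp only [Nat.cast_zero, add_zero] at ha ⊢
    exact hstep j ha fun h₁ h₂ => absurd ⟨h₁, h₂⟩ h
  | succ n ih =>
    rw [Nat.cast_succ, ← add_assoc] at ha ⊢
    exact hstep _ ha fun h _ => ih h

theorem reaches (hg : X.IsLabeling g) (hgen : ∀ p : G, ∃ w : List D, p = (w.map g).prod)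
    (h : ¬ ∀ i, X.pos (A.edge i) ∧ A.edge (i + 1) = X.turnThree (A.edge i))
    (h' : ¬ ∀ i, X.pos (A.edge i) ∧ A.edge (i + 1) = X.mirror.turnThree (A.edge i)) (p : G) :
    A.Reaches p := by
  have hB : X.Extendable g A.IsEnd := fun p a => IsEnd.exists_isEnd A
  have hB' : X.mirror.Extendable g A.IsEnd := fun p a => IsEnd.exists_isEnd A.mirror
  obtain ⟨w, hw⟩ := hgen ((A.pot (0 + 1))⁻¹ * p)
  obtain ⟨a, ha⟩ := ray_mul_prod hB hg
    (fun _ _ => A.shiftable_of_exists_le hB hg (fun _ _ => id)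
      (A.exists_le_of_not_forall (P := fun e f => X.pos e ∧ f = X.turnThree e) h))
    (fun _ _ => A.mirror.shiftable_of_exists_le hB' hg.mirror (fun _ _ => id)
      (A.exists_le_of_not_forall (P := fun e f => X.pos e ∧ f = X.mirror.turnThree e) h'))
    (.base ⟨0, rfl, rfl⟩) w
  rw [← hw, mul_inv_cancel_left] at ha
  obtain ⟨-, h⟩ := reaches_of_ray (fun _ : Unit => A) (fun _ _ h => ⟨(), h⟩) ha
  exact h

/-- The axis on the other side of the triangles to the right of an axis that makes only turns with
three triangles on the right. -/
def shift (hg : X.IsLabeling g)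
    (h : ∀ i, X.pos (A.edge i) ∧ A.edge (i + 1) = X.mirror.turnThree (A.edge i)) : Axis X g where
  deck := A.deck
  length := A.length
  length_pos := A.length_pos
  edge i := X.mirror.shiftSnd (A.edge i)
  pot i := A.pot i * g (X.mirror.shiftFst (A.edge i))
  periodic i := by rw [A.periodic]
  good i := by
    convert! X.good_turnThree _ using 1
    rw [(h i).2]
    simp [shiftSnd, turnThree]
  pot_add_one i := by
    rw [A.pot_add_one, (h i).2, mul_assoc, mul_assoc, hg.mirror.shiftFst_mul_shiftSnd]
  pot_add_length i := by rw [A.pot_add_length, A.periodic, mul_assoc]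

theorem turnThree_shift (hg : X.IsLabeling g)
    (h : ∀ i, X.pos (A.edge i) ∧ A.edge (i + 1) = X.mirror.turnThree (A.edge i)) (i : ℤ) :
    X.pos ((A.shift hg h).edge i) ∧
      (A.shift hg h).edge (i + 1) = X.turnThree ((A.shift hg h).edge i) := by
  simp only [shift]
  rw [(h i).2]
  refine ⟨?_, ?_⟩
  · simpa [shiftSnd] using (h i).1
  · simp [shiftSnd, turnThree]

/-- On the side where a shift of one line would propagate forever, it lands on the other line, from
which a ray can start directly. -/
theorem reaches_or_shift_reaches (hg : X.IsLabeling g)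
    (hgen : ∀ p : G, ∃ w : List D, p = (w.map g).prod)
    (h : ∀ i, X.pos (A.edge i) ∧ A.edge (i + 1) = X.mirror.turnThree (A.edge i)) (p : G) :
    A.Reaches p ∨ (A.shift hg h).Reaches p := by
  set A' := A.shift hg h with hA'
  have h' : ∀ i, X.pos (A'.edge i) ∧ A'.edge (i + 1) = X.turnThree (A'.edge i) :=
    A.turnThree_shift hg h
  let B : G → D → Prop := fun p a => ∃ k, (Bool.rec A A' k : Axis X g).IsEnd p a
  have hBA : ∀ p a, A.IsEnd p a → B p a := fun _ _ h => ⟨false, h⟩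
  have hBA' : ∀ p a, A'.IsEnd p a → B p a := fun _ _ h => ⟨true, h⟩
  have hB : X.Extendable g B := by
    rintro p a ⟨k, hk⟩
    obtain ⟨q, b, hq, hb⟩ := hk.exists_isEnd
    exact ⟨q, b, ⟨k, hq⟩, hb⟩
  have hB' : X.mirror.Extendable g B := fun p a hp => by simpa [good_mirror] using hB p a hp
  have hs : ∀ p a, B p a → X.pos a → X.Shiftable g B p a := by
    rintro p a ⟨_ | _, hk⟩ ha
    · exact A.shiftable_of_exists_le hB hg hBA
        (fun i => ⟨i, le_rfl, fun hi =>
          X.turnThree_ne_mirror_turnThree (A.edge i) (hi.2.symm.trans (h i).2)⟩) hk ha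
    · obtain ⟨i, rfl, rfl⟩ := hk
      -- Crossing the triangle to the left of this edge leads to the end of edge `i` of `A`.
      refine ⟨A.edge i, .base (hBA _ _ ⟨i, ?_, rfl⟩), .inr ⟨(h i).1, ?_⟩⟩
      · change A'.pot (i + 1) * _ * g (X.shiftFst (A'.edge i)) = _
        rw [A'.pot_add_one, mul_inv_cancel_right, A.pot_add_one]
        simp only [hA', shift]
        rw [show X.mirror.shiftFst (A.edge i) = X.next (X.rev (A.edge i)) by simp [shiftFst],
          show X.shiftFst (X.mirror.shiftSnd (A.edge i)) = X.next (X.next (X.rev (A.edge i))) by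
            simp [shiftFst, shiftSnd], hg.next_next, hg.rev]
        group
      · change X.shiftSnd (A'.edge i) = _
        simp [hA', shift, shiftSnd, turnThree]
  have hs' : ∀ p a, B p a → X.pos a → X.mirror.Shiftable g B p a := by
    rintro p a ⟨_ | _, hk⟩ ha
    · obtain ⟨i, rfl, rfl⟩ := hk
      -- Crossing the triangle to the right of edge `i` of `A` leads to the end of edge `i - 1` of
      -- the parallel line.
      refine ⟨A'.edge (i - 1), .base (hBA' _ _ ⟨i - 1, ?_, rfl⟩), .inr ⟨(h' (i - 1)).1, ?_⟩⟩
      · change A.pot (i + 1) * _ * g (X.mirror.shiftFst (A.edge i)) = _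
        rw [A.pot_add_one, mul_inv_cancel_right, sub_add_cancel]
        rfl
      · rw [mirror_mirror, ← (h' (i - 1)).2, sub_add_cancel]
        rfl
    · exact A'.mirror.shiftable_of_exists_le hB' hg.mirror hBA'
        (fun i => ⟨i, le_rfl, fun hi => X.turnThree_ne_mirror_turnThree (A'.edge i)
          ((h' i).2.symm.trans hi.2)⟩) hk ha
  obtain ⟨w, hw⟩ := hgen ((A.pot (0 + 1))⁻¹ * p)
  obtain ⟨a, ha⟩ := ray_mul_prod hB hg hs hs' (.base (hBA _ _ ⟨0, rfl, rfl⟩)) w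
  rw [← hw, mul_inv_cancel_left] at ha
  obtain ⟨_ | _, h⟩ := reaches_of_ray _ (fun _ _ h => h) ha
  · exact .inl h
  · exact .inr h

end Axis

/-! #### Reversal -/

/-- Reversal changes k-turns into -k-turns. The triangle to the left of the reversed second edge has
the color of the one to the left of the first edge if k is even, and the opposite color if k is odd.
So 2_r- and -2_r-turns are exchanged, whereas 3_r-turns correspond to -3_b-turns. -/
theorem Good.rev {e f : D} (h : X.Good e f) : X.Good (X.rev f) (X.rev e) := by
  obtain ⟨h0, h1, h1', h2, h2'⟩ := X.good_iff.1 h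
  have key : ∀ x, X.rev e = x → e = X.rev x := fun x h => by rw [← h, X.rev_rev]
  refine X.good_iff.2 ⟨fun h => h0 ?_, fun h => h1' ?_, fun h => h1 ?_, fun hf h => h2' ?_ ?_,
    fun hf h => h2 ?_ ?_⟩
  all_goals
    have := key _ h
    subst this
    simp_all

theorem Irreducible.reverse {u : List D} (h : X.Irreducible u) :
    X.Irreducible (u.map X.rev).reverse := by
  refine List.isChain_reverse.2 ((List.isChain_map _).2 (h.imp fun _ _ h => h.rev))

theorem IsLabeling.prod_reverse (hg : X.IsLabeling g) (u : List D) :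
    ((u.map X.rev).reverse.map g).prod = (u.map g).prod⁻¹ := by
  induction u with
  | nil => simp
  | cons e u ih => simp_all [hg.rev]

namespace Axis

variable (A : Axis X g)

/-- The axis traversed backwards. -/
@[simps]
def reverse (hg : X.IsLabeling g) : Axis X g where
  deck := A.deck⁻¹
  length := A.length
  length_pos := A.length_pos
  edge i := X.rev (A.edge (-1 - i))
  pot i := A.pot (-i)
  periodic i := by
    rw [← A.periodic]
    congr 2
    ring
  good i := by
    convert! (A.good (-1 - (i + 1))).rev using 3
    ring
  pot_add_one i := by
    rw [hg.rev, eq_mul_inv_iff_mul_eq, show -(i + 1) = -1 - i by ring, ← A.pot_add_one]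
    congr 1
    ring
  pot_add_length i := by
    rw [eq_inv_mul_iff_mul_eq, ← A.pot_add_length]
    congr 1
    ring

theorem ReachedFrom.of_reverse (hg : X.IsLabeling g) {p : G} (h : (A.reverse hg).Reaches p) :
    A.ReachedFrom p := by
  obtain ⟨i, w, rfl, hw⟩ := h
  refine ⟨-i, (w.map X.rev).reverse, ?_, ?_⟩
  · rw [hg.prod_reverse, mul_inv_cancel_right]
    rfl
  · convert! hw.reverse using 1
    simp only [reverse_edge, List.map_cons, List.reverse_cons, rev_rev]
    congr 3
    ring

variable {A}

theorem forall_of_reverse (hg : X.IsLabeling g)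
    (h : ∀ i, X.pos ((A.reverse hg).edge i) ∧
      (A.reverse hg).edge (i + 1) = X.turnThree ((A.reverse hg).edge i)) (i : ℤ) :
    ¬ X.pos (A.edge i) ∧ A.edge (i + 1) = X.mirror.turnThree (A.edge i) := by
  have h₁ := (h (-1 - i)).1
  have h₂ := (h (-1 - (i + 1))).2
  simp only [reverse_edge, sub_sub_cancel, pos_rev,
    show -1 - (-1 - (i + 1) + 1) = i by ring] at h₁ h₂
  refine ⟨h₁, ?_⟩
  rw [← X.rev_rev (A.edge i), h₂]
  simp [turnThree]

theorem forall_of_reverse' (hg : X.IsLabeling g)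
    (h : ∀ i, X.pos ((A.reverse hg).edge i) ∧
      (A.reverse hg).edge (i + 1) = X.mirror.turnThree ((A.reverse hg).edge i)) (i : ℤ) :
    ¬ X.pos (A.edge i) ∧ A.edge (i + 1) = X.turnThree (A.edge i) := by
  have h₁ := (h (-1 - i)).1
  have h₂ := (h (-1 - (i + 1))).2
  simp only [reverse_edge, sub_sub_cancel, pos_rev,
    show -1 - (-1 - (i + 1) + 1) = i by ring] at h₁ h₂
  refine ⟨h₁, ?_⟩
  rw [← X.rev_rev (A.edge i), h₂]
  simp [turnThree]

theorem forall_of_reverse_neg (hg : X.IsLabeling g)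
    (h : ∀ i, ¬ X.pos ((A.reverse hg).edge i) ∧
      (A.reverse hg).edge (i + 1) = X.mirror.turnThree ((A.reverse hg).edge i)) (i : ℤ) :
    X.pos (A.edge i) ∧ A.edge (i + 1) = X.turnThree (A.edge i) := by
  have h₁ := (h (-1 - i)).1
  have h₂ := (h (-1 - (i + 1))).2
  simp only [reverse_edge, sub_sub_cancel, pos_rev, not_not,
    show -1 - (-1 - (i + 1) + 1) = i by ring] at h₁ h₂
  refine ⟨h₁, ?_⟩
  rw [← X.rev_rev (A.edge i), h₂]
  simp [turnThree]

theorem reachedFrom (hg : X.IsLabeling g) (hgen : ∀ p : G, ∃ w : List D, p = (w.map g).prod)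
    (h : ¬ ∀ i, ¬ X.pos (A.edge i) ∧ A.edge (i + 1) = X.mirror.turnThree (A.edge i))
    (h' : ¬ ∀ i, ¬ X.pos (A.edge i) ∧ A.edge (i + 1) = X.turnThree (A.edge i)) (p : G) :
    A.ReachedFrom p :=
  .of_reverse A hg ((A.reverse hg).reaches hg hgen (fun H => h (forall_of_reverse hg H))
    (fun H => h' (forall_of_reverse' hg H)) p)

/-! #### Comparison of two axes -/

/-- Both words lead from `A.pot 0` to the translate of `B.pot 0` by the `k`-th power of the common
deck transformation, and neither has a bad turn. -/
theorem eq_segment_append {A B : Axis X X.gen} (hAB : A.deck = B.deck) {i j : ℤ} {v w : List D}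
    (hw : B.pot 0 = A.pot i * (w.map X.gen).prod) (hw' : X.Irreducible (A.edge (i - 1) :: w))
    (hv : A.pot 0 * (v.map X.gen).prod = B.pot j) (hv' : X.Irreducible (v ++ [B.edge j]))
    {k m n : ℕ} (hm : (m : ℤ) = i + k * A.length) (hn : j + n = k * B.length) :
    v ++ B.segment j n = A.segment 0 m ++ w := by
  have hA : X.Irreducible (A.edge (m - 1 : ℤ) :: w) := by
    rwa [hm, add_sub_right_comm, ← Int.cast_natCast k, Int.cast_id, A.edge_add_mul]
  have hA' := A.irreducible_segment_append hA m
  rw [sub_self] at hA'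
  refine (B.irreducible_append_segment hv' n).eq_of_prod_gen_eq X hA' ?_
  rw [← mul_right_inj (A.pot 0)]
  simp only [List.map_append, List.prod_append, ← mul_assoc]
  rw [hv, B.pot_mul_prod_segment, A.pot_mul_prod_segment, hn, zero_add, hm, A.pot_add_mul,
    mul_assoc, ← hw, hAB, ← B.pot_add_mul, zero_add]

theorem exists_shift_of_reaches {A B : Axis X X.gen} (hAB : A.deck = B.deck)
    (hA : A.Reaches (B.pot 0)) (hB : B.ReachedFrom (A.pot 0)) :
    A.length = B.length ∧ ∃ k : ℤ, ∀ i, A.edge i = B.edge (i + k) := by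
  obtain ⟨i, w, hw, hw'⟩ := hA
  obtain ⟨j, v, hv, hv'⟩ := hB
  have hLA : (1 : ℤ) ≤ A.length := by exact_mod_cast A.length_pos
  have hLB : (1 : ℤ) ≤ B.length := by exact_mod_cast B.length_pos
  have key : ∀ k : ℕ, |i| + |j| ≤ k → ∃ m n : ℕ, (m : ℤ) = i + k * A.length ∧
      j + n = k * B.length ∧ v ++ B.segment j n = A.segment 0 m ++ w := by
    intro k hk
    have h₁ : (k : ℤ) * 1 ≤ k * A.length := by gcongr
    have h₂ : (k : ℤ) * 1 ≤ k * B.length := by gcongr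
    have h₃ := neg_abs_le i
    have h₄ := le_abs_self j
    have h₅ := abs_nonneg i
    have h₆ := abs_nonneg j
    have hm : ((i + k * A.length).toNat : ℤ) = i + k * A.length := Int.toNat_of_nonneg (by linarith)
    have hn : j + ((k * B.length - j).toNat : ℤ) = k * B.length := by
      rw [Int.toNat_of_nonneg (by linarith), add_sub_cancel]
    exact ⟨_, _, hm, hn, eq_segment_append hAB hw hw' hv hv' hm hn⟩
  -- Passing from `k` to `k + 1` lengthens one word by a period of `A` and the other by a period of
  -- `B`.
  have hlen : (A.length : ℤ) = B.length := by
    obtain ⟨m, n, hm, hn, h⟩ := key (|i| + |j|).toNat (by rw [Int.toNat_of_nonneg (by positivity)])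
    obtain ⟨m', n', hm', hn', h'⟩ := key ((|i| + |j|).toNat + 1)
      (by push_cast; rw [Int.toNat_of_nonneg (by positivity)]; linarith)
    have h₁ := congrArg List.length h
    have h₂ := congrArg List.length h'
    simp only [List.length_append, length_segment] at h₁ h₂
    push_cast at hm' hn'
    have h₁' : (v.length : ℤ) + n = m + w.length := by exact_mod_cast h₁
    have h₂' : (v.length : ℤ) + n' = m' + w.length := by exact_mod_cast h₂
    linarith
  -- For large `k`, the letter number `t` lies in the segment of `A` in one word and, beyond `v`, in
  -- the segment of `B` in the other.
  have hedge : ∀ t : ℕ, v.length ≤ t → A.edge t = B.edge (t + (j - v.length)) := by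
    intro t ht
    obtain ⟨m, n, hm, hn, h⟩ := key ((|i| + |j|).toNat + t + 1)
      (by push_cast; rw [Int.toNat_of_nonneg (by positivity)]; linarith)
    have htm : t < m := by
      have h₁ : (((|i| + |j|).toNat + t + 1 : ℕ) : ℤ) * 1 ≤
        ((|i| + |j|).toNat + t + 1 : ℕ) * A.length := by gcongr
      have h₃ := neg_abs_le i
      have h₄ := abs_nonneg j
      push_cast at h₁ hm
      rw [Int.toNat_of_nonneg (by positivity)] at h₁ hm
      have : (t : ℤ) < m := by linarith
      exact_mod_cast this
    have htn : t - v.length < n := by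
      have := congrArg List.length h
      simp only [List.length_append, length_segment] at this
      omega
    have := congrArg (fun u => u[t]?) h
    simp only [List.getElem?_append_right ht] at this
    rw [List.getElem?_append_left (by simpa using htm)] at this
    simp only [segment, List.getElem?_map, List.getElem?_range htm, List.getElem?_range htn,
      Option.map_some, zero_add, Option.some.injEq] at this
    rw [← this]
    congr 1
    push_cast [ht]
    ring
  refine ⟨by exact_mod_cast hlen, j - v.length, fun t => ?_⟩
  obtain ⟨s, hs, hs'⟩ : ∃ s : ℕ, v.length ≤ s ∧ (s : ℤ) = t + (|t| + v.length : ℤ) * A.length := by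
    have h₁ : (|t| + v.length : ℤ) * 1 ≤ (|t| + v.length : ℤ) * A.length := by gcongr
    have h₂ := neg_abs_le t
    refine ⟨(t + (|t| + v.length : ℤ) * A.length).toNat, ?_, Int.toNat_of_nonneg ?_⟩
    · omega
    · have : (0 : ℤ) ≤ v.length := by positivity
      linarith
  have := hedge s hs
  rw [hs', A.edge_add_mul, add_right_comm, hlen, B.edge_add_mul] at this
  exact this

/-- The conditions on the turns of a reduced closed walk, apart from the absence of bad turns. -/
def IsReduced (A : Axis X g) : Prop :=
  (¬ ∀ i, X.pos (A.edge i) ∧ A.edge (i + 1) = X.turnThree (A.edge i)) ∧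
    ¬ ∀ i, ¬ X.pos (A.edge i) ∧ A.edge (i + 1) = X.mirror.turnThree (A.edge i)

theorem IsReduced.reverse (hg : X.IsLabeling g) (h : A.IsReduced) : (A.reverse hg).IsReduced :=
  ⟨fun H => h.2 (forall_of_reverse hg H), fun H => h.1 (forall_of_reverse_neg hg H)⟩

theorem IsReduced.exists_shift_of_not_forall {A B : Axis X X.gen} (hA : A.IsReduced)
    (hB : B.IsReduced) (hAB : A.deck = B.deck)
    (h : ¬ ∀ i, ¬ X.pos (B.edge i) ∧ B.edge (i + 1) = X.turnThree (B.edge i)) :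
    A.length = B.length ∧ ∃ k : ℤ, ∀ i, A.edge i = B.edge (i + k) := by
  have hg := X.isLabeling_gen
  have hgen := X.exists_eq_prod_gen
  by_cases hA' : ∀ i, X.pos (A.edge i) ∧ A.edge (i + 1) = X.mirror.turnThree (A.edge i)
  · rcases A.reaches_or_shift_reaches hg hgen hA' (B.pot 0) with hr | hr
    · exact exists_shift_of_reaches hAB hr (B.reachedFrom hg hgen hB.2 h _)
    · obtain ⟨-, k, hk⟩ := exists_shift_of_reaches (A := A.shift hg hA') hAB hr
        (B.reachedFrom hg hgen hB.2 h _)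
      -- If the parallel line reached `B`, then `B` would be a translate of it and make only
      -- 3_r-turns.
      refine absurd (fun i => ?_) hB.1
      have := A.turnThree_shift hg hA' (i - k)
      rw [hk, hk, sub_add_cancel, show i - k + 1 + k = i + 1 by ring] at this
      exact this
  · exact exists_shift_of_reaches hAB (A.reaches hg hgen hA.1 hA' _)
      (B.reachedFrom hg hgen hB.2 h _)

/-- Only an outgoing line with 3_b-turns throughout is problematic. If one of the lines is not of
this type, it takes the outgoing role; if both are, their reversals make only -3_r-turns, and the
previous lemma applies to them. -/
theorem IsReduced.exists_shift {A B : Axis X X.gen} (hA : A.IsReduced)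
    (hB : B.IsReduced) (hAB : A.deck = B.deck) :
    A.length = B.length ∧ ∃ k : ℤ, ∀ i, A.edge i = B.edge (i + k) := by
  by_cases hB' : ∀ i, ¬ X.pos (B.edge i) ∧ B.edge (i + 1) = X.turnThree (B.edge i)
  · by_cases hA' : ∀ i, ¬ X.pos (A.edge i) ∧ A.edge (i + 1) = X.turnThree (A.edge i)
    · have hg := X.isLabeling_gen
      obtain ⟨h, k, hk⟩ := (hA.reverse hg).exists_shift_of_not_forall (hB.reverse hg)
        (congrArg (·⁻¹) hAB) fun H => (hB' _).1 (by simpa using (H 0).1)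
      refine ⟨h, -k, fun i => ?_⟩
      have := hk (-1 - i)
      simp only [reverse_edge, sub_sub_cancel, rev_inj] at this
      rw [this]
      congr 1
      ring
    · obtain ⟨h, k, hk⟩ := hB.exists_shift_of_not_forall hA hAB.symm hA'
      exact ⟨h.symm, -k, fun i => by rw [hk, neg_add_cancel_right]⟩
  · exact hA.exists_shift_of_not_forall hB hAB hB'

end Axis

end SignedMap

namespace ReducingTri.TriMap

/-! #### Open sets in the glued surface -/

section Nhd

variable {D : Type*} (M : TriMap D)

/-- The side of a triangle that starts at the corner `i`, if `e` starts at the corner `0`. -/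
def side (e : D) (i : Fin 3) : D := (M.next ^ (i : ℕ)) e

theorem side_next (e : D) (i : Fin 3) : M.side (M.next e) i = M.side e (i + 1) := by
  fin_cases i <;> simp [side, pow_succ, M.next_next_next]

theorem side_injective (e : D) : Function.Injective (M.side e) := by
  have h₁ := M.next_ne e
  have h₂ := M.next_ne (M.next e)
  have h₃ := M.next_ne (M.next (M.next e))
  rw [M.next_next_next] at h₃
  intro i j h
  fin_cases i <;> fin_cases j <;> simp_all [side, pow_succ, eq_comm]

/-- The points near the corners `i` of triangles such that the side that starts at `i` satisfies a
property of directed edges that depends only on their source. -/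
def vertexNhd (A : D → Prop) (hA : ∀ e, A (M.rot e) ↔ A e) : Set M.Realization :=
  {z | Quot.lift (fun z : Σ _ : D, Triangle => ∃ i, 1 / 2 < z.2.1 i ∧ A (M.side z.1 i)) (by
    rintro _ _ (⟨e, x, y, h⟩ | ⟨e, x, y, hx, hy, h₀, h₁⟩)
    · simp only [side_next, h]
      exact propext (Function.Surjective.exists (p := fun i => 1 / 2 < x.1 i ∧ A (M.side e i))
        (Equiv.addRight (1 : Fin 3)).surjective)
    · have h2 := hA (M.rev e)
      simp only [rot, Equiv.Perm.mul_apply, M.rev_rev] at h2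
      have h3 := hA e
      simp only [rot, Equiv.Perm.mul_apply] at h3
      simp [Fin.exists_fin_succ, hx, hy, h₀, h₁, side, h2, h3, (by norm_num : ¬ (2 : ℝ) < 0),
        or_comm]) z}

/-- The points near the interiors of the edges that satisfy a property of undirected edges, together
with the interiors of the adjacent triangles. -/
def edgeNhd (A : D → Prop) (hA : ∀ e, A (M.rev e) ↔ A e) : Set M.Realization :=
  {z | Quot.lift (fun z : Σ _ : D, Triangle =>
      ∃ i, 0 < z.2.1 i ∧ 0 < z.2.1 (i + 1) ∧ A (M.side z.1 i)) (by
    rintro _ _ (⟨e, x, y, h⟩ | ⟨e, x, y, hx, hy, h₀, h₁⟩)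
    · simp only [side_next, h]
      exact propext (Function.Surjective.exists
        (p := fun i => 0 < x.1 i ∧ 0 < x.1 (i + 1) ∧ A (M.side e i))
        (Equiv.addRight (1 : Fin 3)).surjective)
    · simp [Fin.exists_fin_succ, hx, hy, h₀, h₁, side, hA, and_left_comm]) z}

theorem isOpen_vertexNhd (A : D → Prop) (hA : ∀ e, A (M.rot e) ↔ A e) :
    IsOpen (M.vertexNhd A hA) := by
  refine isQuotientMap_quot_mk.isOpen_preimage.1 (isOpen_sigma_iff.2 fun e => ?_)
  change IsOpen {x : Triangle | ∃ i, 1 / 2 < x.1 i ∧ A (M.side e i)}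
  simp only [Set.ofPred_exists, Set.ofPred_and]
  refine isOpen_iUnion fun i => .inter (isOpen_lt continuous_const ?_) isOpen_const
  exact (continuous_apply i).comp continuous_subtype_val

theorem isOpen_edgeNhd (A : D → Prop) (hA : ∀ e, A (M.rev e) ↔ A e) :
    IsOpen (M.edgeNhd A hA) := by
  refine isQuotientMap_quot_mk.isOpen_preimage.1 (isOpen_sigma_iff.2 fun e => ?_)
  change IsOpen {x : Triangle | ∃ i, 0 < x.1 i ∧ 0 < x.1 (i + 1) ∧ A (M.side e i)}
  simp only [Set.ofPred_exists, Set.ofPred_and]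
  refine isOpen_iUnion fun i => .inter (isOpen_lt continuous_const ?_)
    (.inter (isOpen_lt continuous_const ?_) isOpen_const)
  · exact (continuous_apply i).comp continuous_subtype_val
  · exact (continuous_apply (i + 1)).comp continuous_subtype_val

/-- The point with barycentric coordinates `x` of the triangle to the left of `e`. -/
def point (e : D) (x : Triangle) : M.Realization := Quot.mk _ ⟨e, x⟩

theorem exists_eq_point (z : M.Realization) : ∃ e x, z = M.point e x := by
  obtain ⟨⟨e, x⟩⟩ := z
  exact ⟨e, x, rfl⟩

end Nhd

/-! #### The covering defined by a labeling -/

section Cover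

variable {D : Type*} {M : TriMap D} {G : Type*} [Group G] {g : D → G}

/-- A map to a group that is compatible with reversal and with the triangles. -/
structure IsLabeling (M : TriMap D) (g : D → G) : Prop where
  rev : ∀ e, g (M.rev e) = (g e)⁻¹
  triangle : ∀ e, g e * g (M.next e) * g (M.next (M.next e)) = 1

namespace IsLabeling

variable (hg : M.IsLabeling g)

/-- The permutation that lifts `M.next` to the covering surface. -/
def coverNext : Equiv.Perm (D × G) where
  toFun a := (M.next a.1, a.2 * g a.1)
  invFun a := (M.next (M.next a.1), a.2 * g a.1 * g (M.next a.1))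
  left_inv a := Prod.ext (M.next_next_next _) (by simp [mul_assoc, ← hg.triangle a.1])
  right_inv a := Prod.ext (M.next_next_next _) (by simp [mul_assoc, ← hg.triangle a.1])

/-- The permutation that lifts `M.rev` to the covering surface. -/
def coverRev : Equiv.Perm (D × G) where
  toFun a := (M.rev a.1, a.2 * g a.1)
  invFun a := (M.rev a.1, a.2 * g a.1)
  left_inv a := Prod.ext (M.rev_rev _) (by simp [hg.rev])
  right_inv a := Prod.ext (M.rev_rev _) (by simp [hg.rev])

/-- The labels of an edge and its reverse cancel, so turning around a vertex stays in the same sheet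
and the covering is unramified at the vertices. -/
theorem coverNext_mul_coverRev_zpow (k : ℤ) (e : D) (h : G) :
    ((hg.coverNext * hg.coverRev) ^ k) (e, h) = ((M.rot ^ k) e, h) := by
  have hrot : ∀ e, (hg.coverNext * hg.coverRev) (e, h) = (M.rot e, h) := fun e => by
    simp [coverNext, coverRev, rot, hg.rev]
  induction k using Int.induction_on with
  | zero => rfl
  | succ n ih => rw [add_comm, zpow_one_add, zpow_one_add, Equiv.Perm.mul_apply, ih, hrot]; rfl
  | pred n ih =>
    apply (hg.coverNext * hg.coverRev).injective
    rw [hrot, ← Equiv.Perm.mul_apply, ← Equiv.Perm.mul_apply, ← zpow_one_add, ← zpow_one_add,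
      add_sub_cancel, ih]

/-- The triangulation of the covering surface defined by a labeling. -/
def cover : TriMap (D × G) where
  next := hg.coverNext
  rev := hg.coverRev
  next_next_next a := Prod.ext (M.next_next_next _)
    (by simp [coverNext, mul_assoc, ← hg.triangle a.1])
  next_ne a h := M.next_ne a.1 (congrArg Prod.fst h)
  rev_rev a := Prod.ext (M.rev_rev _) (by simp [coverRev, hg.rev])
  rev_ne a h := M.rev_ne a.1 (congrArg Prod.fst h)
  locallyFinite a := by
    refine ((M.locallyFinite a.1).image fun e => (e, a.2)).subset ?_
    rintro _ ⟨k, rfl⟩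
    exact ⟨(M.rot ^ k) a.1, ⟨k, rfl⟩, (hg.coverNext_mul_coverRev_zpow k a.1 a.2).symm⟩

theorem cover_next (e : D) (h : G) : hg.cover.next (e, h) = (M.next e, h * g e) := rfl

theorem cover_rev (e : D) (h : G) : hg.cover.rev (e, h) = (M.rev e, h * g e) := rfl

theorem cover_rot (e : D) (h : G) : hg.cover.rot (e, h) = (M.rot e, h) :=
  hg.coverNext_mul_coverRev_zpow 1 e h

theorem fst_cover_side (a : D × G) (i : Fin 3) : (hg.cover.side a i).1 = M.side a.1 i := by
  fin_cases i <;> rfl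

theorem cover_side_mul (γ : G) (a : D × G) (i : Fin 3) : hg.cover.side (a.1, γ * a.2) i =
    ((hg.cover.side a i).1, γ * (hg.cover.side a i).2) := by
  obtain ⟨e, h⟩ := a
  fin_cases i <;> simp [side, pow_succ, cover_next, mul_assoc]

theorem cover_source_eq {e e' : D} {h : G} (he : M.source e = M.source e') :
    hg.cover.source (e, h) = hg.cover.source (e', h) := by
  obtain ⟨k, hk⟩ : M.rot.SameCycle e e' := Quotient.exact he
  exact Quotient.sound ⟨k, hk ▸ hg.coverNext_mul_coverRev_zpow k e h⟩

/-- The covering map. -/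
def proj : hg.cover.Realization → M.Realization :=
  Quot.map (fun z => ⟨z.1.1, z.2⟩) fun z z' h => by
    cases h with
    | rotate a x y h => exact .rotate a.1 x y h
    | side a x y hx hy h₀ h₁ => exact .side a.1 x y hx hy h₀ h₁

theorem isQuotientMap_proj : Topology.IsQuotientMap hg.proj := by
  let f : (Σ _ : D × G, Triangle) → Σ _ : D, Triangle := fun z => ⟨z.1.1, z.2⟩
  have hf : Continuous f := continuous_sigma fun a =>
    continuous_sigmaMk (σ := fun _ : D => Triangle) (i := a.1)
  have hf' : IsOpenMap f := isOpenMap_sigma.2 fun a =>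
    isOpenMap_sigmaMk (σ := fun _ : D => Triangle) (i := a.1)
  have hf'' : Function.Surjective f := fun z => ⟨⟨(z.1, 1), z.2⟩, rfl⟩
  have hp : Continuous hg.proj := continuous_quot_lift _ (continuous_quot_mk.comp hf)
  exact .of_comp continuous_quot_mk hp
    (isQuotientMap_quot_mk.comp (hf'.isQuotientMap hf hf'') : Topology.IsQuotientMap
      (Quot.mk M.Glue ∘ f))

/-- The deck transformations. -/
instance : MulAction G hg.cover.Realization where
  smul γ := Quot.map (fun z => ⟨(z.1.1, γ * z.1.2), z.2⟩) fun z z' h => by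
    cases h with
    | rotate a x y h =>
      convert! Glue.rotate (M := hg.cover) (a.1, γ * a.2) x y h using 2
      exact Prod.ext rfl (mul_assoc ..).symm
    | side a x y hx hy h₀ h₁ =>
      convert! Glue.side (M := hg.cover) (a.1, γ * a.2) x y hx hy h₀ h₁ using 2
      exact Prod.ext rfl (mul_assoc ..).symm
  one_smul := by
    rintro ⟨⟨a, x⟩⟩
    exact congrArg (Quot.mk _) (congrArg (Sigma.mk · x) (Prod.ext rfl (one_mul _)))
  mul_smul γ γ' := by
    rintro ⟨⟨a, x⟩⟩
    exact congrArg (Quot.mk _) (congrArg (Sigma.mk · x) (Prod.ext rfl (mul_assoc ..)))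

theorem smul_point (γ : G) (a : D × G) (x : Triangle) :
    γ • hg.cover.point a x = hg.cover.point (a.1, γ * a.2) x := rfl

theorem smul_edgePoint (γ : G) (a : D × G) (t : unitInterval) :
    γ • hg.cover.edgePoint a t = hg.cover.edgePoint (a.1, γ * a.2) t := rfl

theorem proj_edgePoint (a : D × G) (t : unitInterval) :
    hg.proj (hg.cover.edgePoint a t) = M.edgePoint a.1 t := rfl

theorem proj_eq_iff {z z' : hg.cover.Realization} :
    hg.proj z = hg.proj z' ↔ z ∈ MulAction.orbit G z' := by
  constructor
  · intro h
    obtain ⟨⟨e, γ⟩, x, rfl⟩ := hg.cover.exists_eq_point z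
    obtain ⟨⟨e', γ'⟩, x', rfl⟩ := hg.cover.exists_eq_point z'
    -- A chain of gluings below lifts to every sheet and multiplies the sheet on the right by a
    -- fixed element, which commutes with the deck action on the left.
    have key : ∀ z z' : Σ _ : D, Triangle, Relation.EqvGen M.Glue z z' → ∃ δ : G, ∀ γ,
        hg.cover.point (z.1, γ) z.2 = hg.cover.point (z'.1, γ * δ) z'.2 := by
      intro z z' h
      induction h with
      | rel z z' h =>
        cases h with
        | rotate e x y h => exact ⟨g e, fun γ => Quot.sound (.rotate (e, γ) x y h)⟩
        | side e x y hx hy h₀ h₁ => exact ⟨g e, fun γ => Quot.sound (.side (e, γ) x y hx hy h₀ h₁)⟩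
      | refl z => exact ⟨1, fun γ => by rw [mul_one]⟩
      | symm z z' _ ih =>
        obtain ⟨δ, h⟩ := ih
        exact ⟨δ⁻¹, fun γ => by rw [h, inv_mul_cancel_right]⟩
      | trans z z' z'' _ _ ih ih' =>
        obtain ⟨δ, h⟩ := ih
        obtain ⟨δ', h'⟩ := ih'
        exact ⟨δ * δ', fun γ => by rw [h, h', mul_assoc]⟩
    obtain ⟨δ, h⟩ := key _ _ (Quot.eqvGen_exact h)
    refine ⟨γ * δ * γ'⁻¹, ?_⟩
    refine Eq.trans ?_ (h γ).symm
    simp [smul_point]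
  · rintro ⟨γ, rfl⟩
    obtain ⟨a, x, rfl⟩ := hg.cover.exists_eq_point z'
    rfl

/-- A point with a coordinate above 1/2 lies near one vertex; otherwise two coordinates are positive
and the point lies near the interior of an edge. In each case the neighborhood meets the copies of a
triangle in one sheet only. In the second case this requires that no triangle is glued to itself
along an edge. -/
theorem exists_disjoint_nhd (hM : ∀ e i j, M.rev (M.side e i) ≠ M.side e j)
    (z : hg.cover.Realization) :
    ∃ U ∈ nhds z, ∀ γ : G, ((γ • ·) '' U ∩ U).Nonempty → γ = 1 := by
  obtain ⟨a, x, rfl⟩ := hg.cover.exists_eq_point z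
  have hx₀ := x.2.1
  have hx₁ := x.2.2
  by_cases h : ∃ i, 1 / 2 < x.1 i
  · obtain ⟨i, hi⟩ := h
    refine ⟨hg.cover.vertexNhd (fun b => b.2 = (hg.cover.side a i).2) fun ⟨e, γ⟩ => by
      rw [cover_rot], (hg.cover.isOpen_vertexNhd _ _).mem_nhds ⟨i, hi, rfl⟩, ?_⟩
    rintro γ ⟨_, ⟨z, hz, rfl⟩, hz'⟩
    obtain ⟨b, y, rfl⟩ := hg.cover.exists_eq_point z
    obtain ⟨j, hj, hj'⟩ := hz
    obtain ⟨k, hk, hk'⟩ := hz'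
    dsimp only at hj hj' hk hk'
    have hy₀ := y.2.1
    have hy₁ := y.2.2
    have hjk : j = k := by
      by_contra hjk
      have := Finset.add_le_sum (fun i _ => hy₀ i) (Finset.mem_univ j) (Finset.mem_univ k) hjk
      rw [hy₁] at this
      linarith
    subst hjk
    rw [cover_side_mul] at hk'
    simpa [hj'] using hk'
  · obtain ⟨i, hi, hi'⟩ : ∃ i, 0 < x.1 i ∧ 0 < x.1 (i + 1) := by
      by_contra! H
      push Not at h
      have k0 := h 0
      have k1 := h 1
      have k2 := h 2
      rw [Fin.sum_univ_three] at hx₁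
      rcases (hx₀ 0).lt_or_eq with h0 | h0
      · have H0 : x.1 1 ≤ 0 := H 0 h0
        have H2 : x.1 0 ≤ 0 := H 2 (by linarith)
        linarith
      · have H1 : x.1 2 ≤ 0 := H 1 (by linarith)
        linarith
    set b := hg.cover.side a i
    refine ⟨hg.cover.edgeNhd (fun c => c = b ∨ c = hg.cover.rev b) fun c => ?_,
      (hg.cover.isOpen_edgeNhd _ _).mem_nhds ⟨i, hi, hi', .inl rfl⟩, ?_⟩
    · rw [Equiv.apply_eq_iff_eq, or_comm]
      exact or_congr_right
        ⟨fun h => by rw [← h, hg.cover.rev_rev], fun h => by rw [h, hg.cover.rev_rev]⟩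
    rintro γ ⟨_, ⟨z, hz, rfl⟩, hz'⟩
    obtain ⟨c, y, rfl⟩ := hg.cover.exists_eq_point z
    obtain ⟨j, -, -, hj⟩ := hz
    obtain ⟨k, -, -, hk⟩ := hz'
    dsimp only at hj hk
    rw [cover_side_mul] at hk
    have key : ∀ d : D × G, hg.cover.side c j = d →
        ((hg.cover.side c k).1, γ * (hg.cover.side c k).2) = d → γ = 1 := by
      rintro _ rfl h
      have h₁ := congrArg Prod.fst h
      simp only [fst_cover_side] at h₁
      obtain rfl := M.side_injective _ h₁
      simpa using congrArg Prod.snd h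
    rcases hj with hj | hj <;> rcases hk with hk | hk
    · exact key _ hj hk
    · have hj₁ := congrArg Prod.fst hj
      have hk₁ := congrArg Prod.fst hk
      simp only [fst_cover_side] at hj₁ hk₁
      exact absurd ((congrArg M.rev hj₁).trans hk₁.symm) (hM _ _ _)
    · have hj₁ := congrArg Prod.fst hj
      have hk₁ := congrArg Prod.fst hk
      simp only [fst_cover_side] at hj₁ hk₁
      exact absurd ((congrArg M.rev hk₁).trans hj₁.symm) (hM _ _ _)
    · exact key _ hj hk

theorem isQuotientCoveringMap (hM : ∀ e i j, M.rev (M.side e i) ≠ M.side e j) :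
    IsQuotientCoveringMap hg.proj G where
  __ := hg.isQuotientMap_proj
  continuous_const_smul γ := by
    refine continuous_quot_lift _ (continuous_quot_mk.comp (continuous_sigma fun a => ?_))
    exact continuous_sigmaMk (σ := fun _ : D × G => Triangle) (i := (a.1, γ * a.2))
  apply_eq_iff_mem_orbit := hg.proj_eq_iff
  disjoint := hg.exists_disjoint_nhd hM

end IsLabeling

end Cover

end ReducingTri.TriMap

namespace ReducingTri.TriMap

/-! #### Lifts of closed walks -/

section Walk

variable {D : Type*} (M : TriMap D)

/-- The path that traverses the edge number `i` of a bi-infinite sequence of directed edges during the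
time interval `[i, i + 1]`, at constant speed. -/
noncomputable def walkLine (c : ℤ → D) (s : ℝ) : M.Realization :=
  M.edgePoint (c ⌊s⌋) ⟨Int.fract s, Int.fract_nonneg s, (Int.fract_lt_one s).le⟩

theorem walkLine_intCast (c : ℤ → D) (i : ℤ) : M.walkLine c i = M.edgePoint (c i) 0 := by
  have h : (⟨Int.fract (i : ℝ), Int.fract_nonneg _, (Int.fract_lt_one _).le⟩ : unitInterval) = 0 :=
    Subtype.ext (Int.fract_intCast i)
  rw [walkLine, Int.floor_intCast, h]

variable {M} in
theorem walkLine_eqOn {c : ℤ → D} (hc : ∀ i, M.target (c i) = M.source (c (i + 1))) (k : ℤ) :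
    Set.EqOn (M.walkLine c)
      (fun s => M.edgePoint (c k) (Set.projIcc 0 1 zero_le_one (s - k)))
      (Set.Icc (k : ℝ) (k + 1)) := by
  rintro s ⟨h0, h1⟩
  rcases h1.lt_or_eq with h1 | rfl
  · have hk : ⌊s⌋ = k := Int.floor_eq_iff.2 ⟨h0, h1⟩
    have hs : s - k ∈ Set.Icc (0 : ℝ) 1 := ⟨by linarith, by linarith⟩
    simp only [walkLine, Int.fract, Set.projIcc_of_mem _ hs, hk]
  · have h := M.walkLine_intCast c (k + 1)
    rw [Int.cast_add, Int.cast_one] at h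
    simp only [h, add_sub_cancel_left, Set.projIcc_right]
    exact (M.edgePoint_one_eq_zero (hc k)).symm

variable {M} in
theorem continuous_walkLine {c : ℤ → D} (hc : ∀ i, M.target (c i) = M.source (c (i + 1))) :
    Continuous (M.walkLine c) := by
  have hlf : LocallyFinite fun k : ℤ => Set.Icc (k : ℝ) (k + 1) :=
    locallyFinite_Icc_of_tendsto tendsto_intCast_atTop_atTop
      (Filter.tendsto_atBot_add_const_right _ _ (tendsto_intCast_atBot_iff.2 Filter.tendsto_id))
  refine hlf.continuous ?_ (fun k => isClosed_Icc) fun k => ?_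
  · exact Set.eq_univ_of_forall fun s => Set.mem_iUnion.2
      ⟨⌊s⌋, Int.floor_le s, (Int.lt_floor_add_one s).le⟩
  · exact (((M.continuous_edgePoint _).comp
      (continuous_projIcc.comp (continuous_id.sub continuous_const))).continuousOn).congr
      (walkLine_eqOn hc k)

theorem ClosedWalk.curve_coe (W : M.ClosedWalk) (s : ℝ) :
    W.curve (s : UnitAddCircle) = M.walkLine W.edge (W.length * s) := rfl

end Walk

/-! ### Integration of labels along bi-infinite sequences -/

section Potential

variable {G : Type*} [Group G]

theorem potential_ext {f φ ψ : ℤ → G} (hφ : ∀ i, φ (i + 1) = φ i * f i)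
    (hψ : ∀ i, ψ (i + 1) = ψ i * f i) (h : φ 0 = ψ 0) (i : ℤ) : φ i = ψ i := by
  induction i using Int.induction_on with
  | zero => exact h
  | succ n ih => rw [hφ, hψ, ih]
  | pred n ih =>
    have h₁ := hφ (-n - 1)
    have h₂ := hψ (-n - 1)
    rw [sub_add_cancel] at h₁ h₂
    exact mul_right_cancel (h₁.symm.trans (ih.trans h₂))

theorem exists_potential (f : ℤ → G) (h : G) :
    ∃ φ : ℤ → G, φ 0 = h ∧ ∀ i, φ (i + 1) = φ i * f i := by
  -- The recursion must run in both directions; the integer powers of this permutation perform it.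
  let σ : Equiv.Perm (ℤ × G) :=
    { toFun := fun x => (x.1 + 1, x.2 * f x.1)
      invFun := fun x => (x.1 - 1, x.2 * (f (x.1 - 1))⁻¹)
      left_inv := fun x => by simp
      right_inv := fun x => by simp }
  have hσ : ∀ i, ((σ ^ i) (0, h)).1 = i := fun i => by
    induction i using Int.induction_on with
    | zero => rfl
    | succ n ih =>
      rw [add_comm, zpow_one_add, Equiv.Perm.mul_apply, add_comm]
      exact congrArg (· + 1) ih
    | pred n ih =>
      rw [sub_eq_neg_add, zpow_add, zpow_neg_one, Equiv.Perm.mul_apply, neg_add_eq_sub]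
      exact congrArg (· - 1) ih
  refine ⟨fun i => ((σ ^ i) (0, h)).2, rfl, fun i => ?_⟩
  beta_reduce
  rw [add_comm, zpow_one_add, Equiv.Perm.mul_apply]
  exact congrArg (fun j => ((σ ^ i) (0, h)).2 * f j) (hσ i)

theorem potential_add_of_periodic {f φ : ℤ → G} {L : ℤ} {γ : G} (hf : ∀ i, f (i + L) = f i)
    (hφ : ∀ i, φ (i + 1) = φ i * f i) (h : φ L = γ * φ 0) (i : ℤ) : φ (i + L) = γ * φ i :=
  potential_ext (f := f) (φ := fun i => φ (i + L)) (ψ := fun i => γ * φ i)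
    (fun i => by rw [add_right_comm, hφ, hf]) (fun i => by rw [hφ, mul_assoc]) (by simpa using h) i

end Potential

/-! ### Lifting a free homotopy -/

namespace IsLabeling

variable {D : Type*} {M : TriMap D} {G : Type*} [Group G] {g : D → G} (hg : M.IsLabeling g)

theorem cover_adjacent {c : ℤ → D} {φ : ℤ → G} (hc : ∀ i, M.target (c i) = M.source (c (i + 1)))
    (hφ : ∀ i, φ (i + 1) = φ i * g (c i)) (i : ℤ) :
    hg.cover.target (c i, φ i) = hg.cover.source (c (i + 1), φ (i + 1)) := by
  rw [target, cover_rev, hφ]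
  exact hg.cover_source_eq (hc i)

theorem walkLine_add {c : ℤ → D} {φ : ℤ → G} {L : ℕ} {γ : G} (hc : ∀ i, c (i + L) = c i)
    (hφ : ∀ i, φ (i + L) = γ * φ i) (s : ℝ) :
    hg.cover.walkLine (fun i => (c i, φ i)) (s + L) =
      γ • hg.cover.walkLine (fun i => (c i, φ i)) s := by
  simp only [walkLine, smul_edgePoint, Int.floor_add_natCast, Int.fract_add_natCast, hc, hφ]

/-- Freely homotopic closed walks have lifts that are invariant under the same deck
transformation. -/
theorem exists_potentials (hg : M.IsLabeling g)
    (hM : ∀ e i j, M.rev (M.side e i) ≠ M.side e j) {W W' : M.ClosedWalk}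
    (h : W.curve.Homotopic W'.curve) : ∃ (γ : G) (φ φ' : ℤ → G),
      (∀ i, φ (i + 1) = φ i * g (W.edge i)) ∧ (∀ i, φ (i + W.length) = γ * φ i) ∧
      (∀ i, φ' (i + 1) = φ' i * g (W'.edge i)) ∧ ∀ i, φ' (i + W'.length) = γ * φ' i := by
  obtain ⟨F⟩ := h
  have hcov := hg.isQuotientCoveringMap hM
  have cov := hcov.isCoveringMap
  have := hcov.isCancelSMul
  have hsmul : ∀ γ : G, Continuous fun z : hg.cover.Realization => γ • z :=
    hcov.continuous_const_smul
  obtain ⟨φ, h0, hφ⟩ := exists_potential (fun i => g (W.edge i)) 1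
  have hφ' : ∀ i, φ (i + W.length) = φ W.length * φ i := potential_add_of_periodic
    (f := fun i => g (W.edge i)) (fun i => by rw [W.periodic]) hφ (by rw [h0, mul_one])
  set γ := φ W.length
  -- The circle is unrolled to the real line, so that the homotopy can be lifted starting from the
  -- lift of `W`.
  let K : C(unitInterval × ℝ, M.Realization) :=
    ⟨fun x => F (x.1, (x.2 : UnitAddCircle)), by fun_prop⟩
  let f : C(ℝ, hg.cover.Realization) :=
    ⟨fun s => hg.cover.walkLine (fun i => (W.edge i, φ i)) (W.length * s),
      (continuous_walkLine (hg.cover_adjacent W.adjacent hφ)).comp (by fun_prop)⟩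
  have hf : ∀ s, f s = hg.cover.walkLine (fun i => (W.edge i, φ i)) (W.length * s) := fun _ => rfl
  have H0 : ∀ s, K (0, s) = hg.proj (f s) := fun s =>
    (F.apply_zero _).trans (W.curve_coe M s)
  let E := cov.liftHomotopy K f H0
  have hE : ∀ x, hg.proj (E x) = K x := fun x => congrFun (cov.liftHomotopy_lifts K f H0) x
  have hE0 : ∀ s, E (0, s) = f s := cov.liftHomotopy_zero K f H0
  -- For fixed `s`, both sides are lifts of the same path in `t`, and they agree at `t = 0`.
  have hEγ : ∀ s t, E (t, s + 1) = γ • E (t, s) := by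
    intro s
    refine congrFun (cov.eq_of_comp_eq (by fun_prop) ((hsmul γ).comp (by fun_prop)) ?_ 0 ?_)
    · ext t
      simp only [Function.comp_apply, hcov.map_smul, hE]
      change F (t, ((s + 1 : ℝ) : UnitAddCircle)) = F (t, (s : UnitAddCircle))
      rw [AddCircle.coe_add_period]
    · rw [hE0, hE0, hf, hf, mul_add, mul_one, hg.walkLine_add W.periodic hφ']
  have hE1 : ∀ s, hg.proj (E (1, s)) = M.walkLine W'.edge (W'.length * s) := fun s =>
    (hE _).trans ((F.apply_one _).trans (W'.curve_coe M s))
  -- The lifted homotopy determines the sheet in which the lift of `W'` starts.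
  obtain ⟨k, hk⟩ : ∃ k : G, E (1, 0) = hg.cover.edgePoint (W'.edge 0, k) 0 := by
    have h₁ : hg.proj (E (1, 0)) = hg.proj (hg.cover.edgePoint (W'.edge 0, 1) 0) := by
      rw [hE1, mul_zero, ← Int.cast_zero (R := ℝ), walkLine_intCast, proj_edgePoint]
    obtain ⟨k, hk⟩ := hg.proj_eq_iff.1 h₁
    exact ⟨k, hk.symm.trans (by simp only [smul_edgePoint, mul_one])⟩
  obtain ⟨ψ, h0', hψ⟩ := exists_potential (fun i => g (W'.edge i)) k
  have hline : ∀ s, E (1, s) =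
      hg.cover.walkLine (fun i => (W'.edge i, ψ i)) (W'.length * s) := by
    refine congrFun (cov.eq_of_comp_eq (by fun_prop)
      ((continuous_walkLine (hg.cover_adjacent W'.adjacent hψ)).comp (by fun_prop)) ?_ 0 ?_)
    · ext s
      exact hE1 s
    · rw [hk, mul_zero, ← Int.cast_zero (R := ℝ), walkLine_intCast, h0']
  refine ⟨γ, φ, ψ, hφ, hφ', hψ, potential_add_of_periodic (f := fun i => g (W'.edge i))
    (fun i => by rw [W'.periodic]) hψ ?_⟩
  have hper : W'.edge W'.length = W'.edge 0 := by simpa using W'.periodic 0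
  have h₁ := hEγ 0 1
  rw [hline, hline, zero_add, mul_one, mul_zero, ← Int.cast_natCast, ← Int.cast_zero (R := ℝ),
    walkLine_intCast, walkLine_intCast, hper, smul_edgePoint] at h₁
  have h₂ : ∀ k : G, hg.cover.edgePoint (W'.edge 0, k) 0 =
      k • hg.cover.edgePoint (W'.edge 0, 1) 0 := fun k => by simp only [smul_edgePoint, mul_one]
  rw [h₂, h₂ (γ * ψ 0)] at h₁
  exact IsCancelSMul.right_cancel _ _ _ h₁

end IsLabeling

end ReducingTri.TriMap

/-! ### Reducing triangulations -/

namespace ReducingTri.ReducingTriangulation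

variable {D S : Type*} [TopologicalSpace S] (T : ReducingTriangulation D S)

/-- If the rotation returned after `k` steps, the vertex would have at most `k` outgoing edges. -/
theorem rot_pow_ne (e : D) {k : ℕ} (hk : 0 < k) (hk' : k < 8) : (T.rot ^ k) e ≠ e := by
  intro h
  have hsub : {e' | T.source e' = T.source e} ⊆ (fun i : ℕ => (T.rot ^ i) e) '' Set.Iio k := by
    intro e' he'
    obtain ⟨n, rfl⟩ : T.rot.SameCycle e e' := Quotient.exact (Eq.symm he')
    have hk0 : (k : ℤ) ≠ 0 := by positivity
    refine ⟨(n % k).toNat, ?_, ?_⟩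
    · have := Int.emod_lt_of_pos n (Int.natCast_pos.2 hk)
      have := Int.emod_nonneg n hk0
      simp only [Set.mem_Iio]
      omega
    · have hz : ((T.rot ^ (k : ℤ)) ^ (n / k)) e = e :=
        Equiv.Perm.zpow_apply_eq_self_of_apply_eq_self (by simpa using h) _
      conv_rhs => rw [← Int.emod_add_mul_ediv n k, zpow_add, Equiv.Perm.mul_apply, zpow_mul, hz]
      beta_reduce
      rw [← zpow_natCast, Int.toNat_of_nonneg (Int.emod_nonneg n hk0)]
  have h₁ := Set.ncard_le_ncard hsub ((Set.finite_Iio k).image _)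
  have h₂ := Set.ncard_image_le (f := fun i : ℕ => (T.rot ^ i) e) (Set.finite_Iio k)
  have h₃ := T.eight_le_degree (T.source e)
  rw [TriMap.degree] at h₃
  have h₄ : (Set.Iio k).ncard = k := by
    rw [← Nat.card_coe_set_eq]; simp
  omega

theorem leftColor_rev_eq_red_iff (e : D) :
    T.leftColor (T.rev e) = .red ↔ ¬ T.leftColor e = .red := by
  have := T.leftColor_rev e
  cases h : T.leftColor e <;> cases h' : T.leftColor (T.rev e) <;> simp_all

/-- The signed structure of a reducing triangulation: the directed edges with a red triangle on the
left are positive. -/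
@[simps]
def signedMap : SignedMap D where
  next := T.next
  rev := T.rev
  pos e := T.leftColor e = .red
  next_next_next := T.next_next_next
  rev_rev := T.rev_rev
  pos_next e := by rw [T.leftColor_next]
  pos_rev := T.leftColor_rev_eq_red_iff
  rot_two_ne e := T.rot_pow_ne e (k := 2) (by norm_num) (by norm_num)
  rot_four_ne e := T.rot_pow_ne e (k := 4) (by norm_num) (by norm_num)
  rot_six_ne e := T.rot_pow_ne e (k := 6) (by norm_num) (by norm_num)

theorem leftColor_side (e : D) (i : Fin 3) : T.leftColor (T.side e i) = T.leftColor e := by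
  fin_cases i <;> simp [TriMap.side, pow_succ, T.leftColor_next]

/-- The colors on the two sides of an edge differ, so these sides belong to different triangles. -/
theorem rev_side_ne (e : D) (i j : Fin 3) : T.rev (T.side e i) ≠ T.side e j := fun h =>
  T.leftColor_rev (T.side e i) (by rw [h, T.leftColor_side, T.leftColor_side])

theorem rot_inv (e : D) : T.rot⁻¹ e = T.rev (T.next (T.next e)) := by
  rw [Equiv.Perm.inv_eq_iff_eq]
  simp [TriMap.rot, T.rev_rev, T.next_next_next]

theorem isTurn_one_iff {e f : D} : T.IsTurn 1 e f ↔ f = T.next e := by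
  simp [TriMap.IsTurn, TriMap.rot, T.rev_rev, eq_comm]

theorem isTurn_iff {e f : D} : (T.IsTurn 0 e f ↔ f = T.rev e) ∧
    (T.IsTurn (-1) e f ↔ f = T.signedMap.mirror.next e) ∧
    (T.IsTurn 2 e f ↔ f = T.next (T.rev (T.next e))) ∧
    (T.IsTurn (-2) e f ↔
      f = T.signedMap.mirror.next (T.rev (T.signedMap.mirror.next e))) ∧
    (T.IsTurn 3 e f ↔ f = T.signedMap.turnThree e) ∧
    (T.IsTurn (-3) e f ↔ f = T.signedMap.mirror.turnThree e) := by
  refine ⟨?_, ?_, ?_, ?_, ?_, ?_⟩ <;> rw [TriMap.IsTurn, eq_comm]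
  · rfl
  · rw [zpow_neg_one, rot_inv]; rfl
  · change f = T.rot (T.rot (T.rev e)) ↔ _
    simp [TriMap.rot, T.rev_rev]
  · change f = (T.rot ^ (-(2 : ℕ) : ℤ)) (T.rev e) ↔ _
    rw [zpow_neg, zpow_natCast, ← inv_pow, pow_two, Equiv.Perm.mul_apply, rot_inv, rot_inv]
    simp [T.rev_rev]
  · change f = T.rot (T.rot (T.rot (T.rev e))) ↔ _
    simp [TriMap.rot, T.rev_rev, SignedMap.turnThree]
  · change f = (T.rot ^ (-(3 : ℕ) : ℤ)) (T.rev e) ↔ _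
    rw [zpow_neg, zpow_natCast, ← inv_pow, pow_succ, pow_two, Equiv.Perm.mul_apply,
      Equiv.Perm.mul_apply, rot_inv, rot_inv, rot_inv]
    simp [T.rev_rev, SignedMap.turnThree]

theorem good_of_not_isBadTurn {e f : D} (h : ¬ T.IsBadTurn e f) : T.signedMap.Good e f := by
  obtain ⟨h0, h1', h2, h2', -⟩ := T.isTurn_iff (e := e) (f := f)
  simp only [IsBadTurn, IsColoredTurn, h0, h1', h2, h2', isTurn_one_iff, not_or, not_and'] at h
  exact T.signedMap.good_iff.2 h

/-- The axis defined by lifting a reduced closed walk. -/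
def axis {W : T.ClosedWalk} (hW : T.IsReduced W) {γ : T.signedMap.EdgeGroup}
    {φ : ℤ → T.signedMap.EdgeGroup} (hφ : ∀ i, φ (i + 1) = φ i * T.signedMap.gen (W.edge i))
    (hφ' : ∀ i, φ (i + W.length) = γ * φ i) : T.signedMap.Axis T.signedMap.gen where
  deck := γ
  length := W.length
  length_pos := W.length_pos
  edge := W.edge
  pot := φ
  periodic := W.periodic
  good i := T.good_of_not_isBadTurn (hW.1 i)
  pot_add_one := hφ
  pot_add_length := hφ'

theorem isReduced_axis {W : T.ClosedWalk} (hW : T.IsReduced W) {γ : T.signedMap.EdgeGroup}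
    {φ : ℤ → T.signedMap.EdgeGroup} (hφ : ∀ i, φ (i + 1) = φ i * T.signedMap.gen (W.edge i))
    (hφ' : ∀ i, φ (i + W.length) = γ * φ i) : (T.axis hW hφ hφ').IsReduced := by
  refine ⟨fun h => hW.2.1 fun i => ?_, fun h => hW.2.2 fun i => ?_⟩
  · exact ⟨T.isTurn_iff.2.2.2.2.1.2 (h i).2, (h i).1⟩
  · refine ⟨T.isTurn_iff.2.2.2.2.2.2 (h i).2, ?_⟩
    have := (h i).1
    change ¬ T.leftColor (W.edge i) = .red at this
    cases hc : T.leftColor (W.edge i) <;> simp_all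

end ReducingTri.ReducingTriangulation

theorem mainTheorem5 {D S : Type*} [TopologicalSpace S] [ConnectedSpace S]
    (T : ReducingTri.ReducingTriangulation D S) (C C' : T.ClosedWalk)
    (hC : T.IsReduced C) (hC' : T.IsReduced C')
    (hnC : ¬ T.Contractible C) (hnC' : ¬ T.Contractible C')
    (hCC' : T.FreelyHomotopic C C') :
    C.CyclicEq C' := by
  have hcurve : C.curve.Homotopic C'.curve := by
    have h := (ContinuousMap.Homotopic.refl
      (T.homeo.symm : C(S, T.toTriMap.Realization))).comp hCC'
    have key : ∀ W : T.ClosedWalk, (T.homeo.symm : C(S, T.toTriMap.Realization)).comp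
        (T.closedCurve W) = W.curve := fun W => by
      ext t
      exact T.homeo.symm_apply_apply (W.curve t)
    rwa [key, key] at h
  have hg : T.IsLabeling T.signedMap.gen :=
    ⟨T.signedMap.isLabeling_gen.rev, T.signedMap.isLabeling_gen.triangle⟩
  obtain ⟨γ, φ, φ', hφ, hφL, hφ', hφL'⟩ := hg.exists_potentials T.rev_side_ne hcurve
  obtain ⟨hlen, k, hk⟩ := (T.isReduced_axis hC' hφ' hφL').exists_shift (T.isReduced_axis hC hφ hφL)
    rfl
  exact ⟨hlen.symm, k, hk⟩
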